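/- Let $\mathbb T=\mathbb R/2\pi\mathbb Z$, and for $f\in L_1(\mathbb T)$ (complex-valued) let $\widehat f_k=\frac1{2\pi}\int_{-\pi}^{\pi}f(t)e^{-ikt}\,dt$, $k\in\mathbb Z$. A point $x\in\mathbb R$ is called a $d$-point of $f$ if the function $F(y)=\int_0^y f(t)\,dt$ is differentiable at $x$, that is, if the finite limit $$d_f(x)=\lim_{h\to0}\frac1h\int_0^h f(x+t)\,dt$$ exists. Let $\alpha>0$ and $\beta>0$, and let $\varphi(x)=(1-|x|^\alpha)_+^\beta$ for $x\in\mathbb R$, where $u_+=\max(u,0)$. Then the following three conditions are equivalent: 1. $\beta>1$; 2. for every $f\in L_1(\mathbb T)$ and every $d$-point $x$ of $f$, $$\lim_{n\to\infty}\sum_{k=-\infty}^{\infty}\varphi\Big(\frac{k}{n+1}\Big)\widehat f_k e^{ikx}=d_f(x);$$ 3. for every $f\in L_1(\mathbb T)$ and every $d$-point $x$ of $f$, the Riesz means $\sum_{k=-\infty}^{\infty}\varphi\big(\frac{k}{n+1}\big)\widehat f_k e^{ikx}$ have some finite limit as $n\to\infty$. (Since $\varphi$ vanishes outside $(-1,1)$,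 the sums are over $|k|\le n$ only.) -/

import Mathlib

open Real Filter Topology MeasureTheory

noncomputable section

instance instFactTwoPiPos : Fact (0 < 2 * π) := ⟨Real.two_pi_pos⟩

/-- The point `x` is a `d`-point of the `2π`-periodic function `f` with value `d_f(x) = d`:
the primitive `F(y) = ∫_0^y f(t) dt` is differentiable at `x`, with derivative `d`. -/
def IsDPointWith (f : AddCircle (2 * π) → ℂ) (x : ℝ) (d : ℂ) : Prop :=
  HasDerivAt (fun y : ℝ => ∫ t in (0 : ℝ)..y, f (t : AddCircle (2 * π))) d x

/-- The linear means `∑_{k ∈ ℤ} φ(k / (n + 1)) f̂_k e^{ikx}` of the Fourier series of `f`. -/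
def multiplierMean (φ : ℝ → ℝ) (f : AddCircle (2 * π) → ℂ) (n : ℕ) (x : ℝ) : ℂ :=
  ∑' k : ℤ, (φ ((k : ℝ) / ((n : ℝ) + 1)) : ℂ) * fourierCoeff f k *
    Complex.exp (Complex.I * (k : ℂ) * (x : ℂ))

/-- The function `φ(x) = (1 - |x|^α)_+^β` that generates the Riesz means. -/
def rieszFun (α β : ℝ) (x : ℝ) : ℝ :=
  (max (1 - |x| ^ α) 0) ^ β

theorem rieszFun_eq_zero {α β : ℝ} (hα : 0 < α) (hβ : 0 < β) {x : ℝ} (hx : 1 ≤ |x|) :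
    rieszFun α β x = 0 := by
  have h : 1 ≤ |x| ^ α := Real.one_le_rpow hx hα.le
  rw [rieszFun, max_eq_right (by linarith), Real.zero_rpow hβ.ne']

/-- The series defining the Riesz means are finite sums over `|k| ≤ n`. -/
theorem multiplierMean_rieszFun {α β : ℝ} (hα : 0 < α) (hβ : 0 < β)
    (f : AddCircle (2 * π) → ℂ) (n : ℕ) (x : ℝ) :
    multiplierMean (rieszFun α β) f n x =
      ∑ k ∈ Finset.Icc (-(n : ℤ)) (n : ℤ),
        (rieszFun α β ((k : ℝ) / ((n : ℝ) + 1)) : ℂ) * fourierCoeff f k *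
          Complex.exp (Complex.I * (k : ℂ) * (x : ℂ)) := by
  refine tsum_eq_sum fun k hk => ?_
  have h1 : (n : ℤ) + 1 ≤ |k| := by
    rw [Finset.mem_Icc, ← abs_le] at hk
    omega
  have h2 : ((n : ℝ) + 1) ≤ |(k : ℝ)| := by exact_mod_cast h1
  have hn : (0 : ℝ) < (n : ℝ) + 1 := by positivity
  have h3 : 1 ≤ |(k : ℝ) / ((n : ℝ) + 1)| := by
    rw [abs_div, abs_of_pos hn, le_div_iff₀ hn]
    linarith
  rw [rieszFun_eq_zero hα hβ h3]
  simp

end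

/-!
Let `β > 1`. Then `x ↦ x φ x` has a derivative `ψ` which is Hölder continuous and Lipschitz in the
mean, so the second differences of the coefficients `i k φ(k / (n + 1))` of the derivative `Kₙ'` of
the kernel are small in `ℓ²`. By Parseval this bounds `∫ t |Kₙ'(t)| dt` over each dyadic annulus,
and the bounds add up to first moments of `Kₙ'` that are bounded and concentrate at the origin.
Integrating `∫ f(x - t) Kₙ(t) dt` by parts against the primitive of `f`, which is differentiable at
`x`, then gives convergence to `d_f(x)`.

Let `β ≤ 1`. Then `φ(1 - u) ≥ c u` near `u = 0`. The hump
`p(t) = ∑_{L ≤ |k| < K} k⁻² e^{ikt} - s L⁻¹ ∑_{0 ≤ k < L} e^{ikt}`, with `s` such that `p(0) = 0`,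
is Lipschitz uniformly in `L` and `K`. The derivative of `e^{iNt} p(t)`, for `N = n + 1`, has a
primitive that is `O(|y|)` and, for a suitable choice of `L`, `K` and `N`, a bounded `L¹` norm; but
the `n`-th mean cuts its spectrum at `N` and sees only the frequencies `N - k` with `L ≤ k < K`, so
that at `0` it is at least of order `∑ k⁻² (N - k) φ(1 - k / N)`, that is, of order `log (K / L)`.
The uniform boundedness principle on `ℓ¹` yields an absolutely
convergent superposition of such functions whose means diverge at `0`.
-/

noncomputable section

/-! ### Trigonometric polynomials -/

/-- The trigonometric polynomial `∑ₖ bₖ e^{ikt}` as a continuous function on the circle. -/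
def trigPoly : (ℤ →₀ ℂ) →ₗ[ℂ] C(AddCircle (2 * π), ℂ) :=
  Finsupp.linearCombination ℂ fourier

theorem fourier_coe_two_pi (k : ℤ) (t : ℝ) :
    fourier k (t : AddCircle (2 * π)) = Complex.exp (Complex.I * k * t) := by
  have hpi : (π : ℂ) ≠ 0 := by exact_mod_cast Real.pi_ne_zero
  rw [fourier_coe_apply]
  push_cast
  field_simp

theorem norm_fourier_apply (k : ℤ) (x : AddCircle (2 * π)) : ‖fourier k x‖ = 1 := by
  rw [fourier_apply, Circle.norm_coe]

theorem trigPoly_single (k : ℤ) (z : ℂ) : trigPoly (Finsupp.single k z) = z • fourier k :=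
  Finsupp.linearCombination_single _ _ _

theorem trigPoly_smul_apply (m : ℤ → ℂ) (b : ℤ →₀ ℂ) (x : AddCircle (2 * π)) :
    trigPoly (m • b) x = ∑ k ∈ b.support, m k * b k * fourier k x := by
  rw [trigPoly, Finsupp.linearCombination_apply, Finsupp.sum_of_support_subset (s := b.support)]
  · simp [ContinuousMap.sum_apply, Finsupp.coe_pointwise_smul]
  · intro k
    simp only [Finsupp.mem_support_iff, Finsupp.coe_pointwise_smul, Pi.smul_apply', smul_eq_mul]
    exact right_ne_zero_of_mul
  · simp

theorem trigPoly_apply (b : ℤ →₀ ℂ) (x : AddCircle (2 * π)) :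
    trigPoly b x = ∑ k ∈ b.support, b k * fourier k x := by
  simp [trigPoly, Finsupp.linearCombination_apply, Finsupp.sum, ContinuousMap.sum_apply]

theorem hasDerivAt_trigPoly (b : ℤ →₀ ℂ) (t : ℝ) :
    HasDerivAt (fun s : ℝ => trigPoly b s) (trigPoly ((fun k : ℤ => Complex.I * k) • b) t) t := by
  have hpi : (π : ℂ) ≠ 0 := by exact_mod_cast Real.pi_ne_zero
  simp only [trigPoly_smul_apply, trigPoly_apply b]
  refine HasDerivAt.fun_sum fun k _ => ?_
  refine ((hasDerivAt_fourier (2 * π) k t).const_mul (b k)).congr_deriv ?_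
  push_cast
  field_simp

theorem fourierCoeff_trigPoly (b : ℤ →₀ ℂ) (k : ℤ) : fourierCoeff (trigPoly b) k = b k := by
  induction b using Finsupp.induction_linear with
  | zero => simp [fourierCoeff]
  | add b c hb hc =>
    rw [map_add, ContinuousMap.coe_add, fourierCoeff.add, Pi.add_apply, hb, hc, Finsupp.add_apply]
    all_goals exact (map_continuous _).integrable_of_hasCompactSupport (.of_compactSpace _)
  | single j z =>
    rw [trigPoly_single, ContinuousMap.coe_smul, fourierCoeff.const_smul, fourierCoeff_fourier,
      Finsupp.single_apply, Pi.single_apply]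
    simp [eq_comm]

theorem integral_haarAddCircle_eq_intervalIntegral {E : Type*} [NormedAddCommGroup E]
    [NormedSpace ℝ E] (g : AddCircle (2 * π) → E) (a : ℝ) :
    ∫ y, g y ∂AddCircle.haarAddCircle =
      (2 * π)⁻¹ • ∫ t in a..a + 2 * π, g (t : AddCircle (2 * π)) := by
  rw [AddCircle.integral_haarAddCircle, AddCircle.intervalIntegral_preimage]

theorem integral_norm_sq_trigPoly (b : ℤ →₀ ℂ) :
    ∫ t in (-π)..π, ‖trigPoly b t‖ ^ 2 = 2 * π * ∑' k, ‖b k‖ ^ 2 := by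
  have parseval := tsum_sq_fourierCoeff
    (ContinuousMap.toLp (E := ℂ) 2 AddCircle.haarAddCircle ℂ (trigPoly b))
  have htoLp := ContinuousMap.coeFn_toLp (E := ℂ) (p := 2) (𝕜 := ℂ)
    AddCircle.haarAddCircle (trigPoly b)
  simp_rw [fourierCoeff_toLp, fourierCoeff_trigPoly] at parseval
  rw [parseval, integral_congr_ae (htoLp.mono fun x hx => congrArg (‖·‖ ^ 2) hx),
    integral_haarAddCircle_eq_intervalIntegral _ (-π), show -π + 2 * π = π by ring, smul_eq_mul]
  field_simp

theorem trigPoly_equivMapDomain_addRight (m : ℤ) (b : ℤ →₀ ℂ) :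
    trigPoly (b.equivMapDomain (Equiv.addRight m)) = fourier m * trigPoly b := by
  rw [trigPoly, Finsupp.linearCombination_equivMapDomain]
  simp only [Finsupp.linearCombination_apply, Finsupp.sum, Finset.mul_sum]
  refine Finset.sum_congr rfl fun k _ => ?_
  ext x
  simp only [Function.comp_apply, Equiv.coe_addRight, ContinuousMap.smul_apply,
    ContinuousMap.mul_apply, fourier_add, smul_eq_mul]
  ring

/-- The backward difference `bₖ - bₖ₋ₘ` of step `m`; it corresponds to multiplication of the
trigonometric polynomial by `1 - e^{imt}`. -/
def stepDiff (m : ℤ) (b : ℤ →₀ ℂ) : ℤ →₀ ℂ :=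
  b - b.equivMapDomain (Equiv.addRight m)

theorem stepDiff_apply (m : ℤ) (b : ℤ →₀ ℂ) (k : ℤ) : stepDiff m b k = b k - b (k - m) := by
  simp [stepDiff, Finsupp.equivMapDomain_apply, sub_eq_add_neg]

theorem trigPoly_stepDiff (m : ℤ) (b : ℤ →₀ ℂ) :
    trigPoly (stepDiff m b) = (1 - fourier m) * trigPoly b := by
  rw [stepDiff, map_sub, trigPoly_equivMapDomain_addRight, sub_mul, one_mul]

/-! ### The dyadic estimate -/

theorem sq_intervalIntegral_le {u : ℝ → ℝ} (hu : Continuous u) {a b : ℝ} (hab : a < b) :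
    (∫ t in a..b, u t) ^ 2 ≤ (b - a) * ∫ t in a..b, u t ^ 2 := by
  have hpos : 0 < b - a := sub_pos.2 hab
  have jensen : (⨍ t in a..b, u t) ^ 2 ≤ ⨍ t in a..b, u t ^ 2 := by
    rw [Set.uIoc_of_le hab.le]
    refine (even_two.convexOn_pow (𝕜 := ℝ)).map_set_average_le (continuous_pow 2).continuousOn
      isClosed_univ ?_ ?_ (by simp) ?_ ?_
    · simpa using hab
    · simp
    · exact hu.integrableOn_Ioc
    · exact (hu.pow 2).integrableOn_Ioc
  rw [interval_average_eq, interval_average_eq, smul_eq_mul, smul_eq_mul, mul_pow] at jensen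
  calc (∫ t in a..b, u t) ^ 2 = (b - a) ^ 2 * ((b - a)⁻¹ ^ 2 * (∫ t in a..b, u t) ^ 2) := by
        field_simp
    _ ≤ (b - a) ^ 2 * ((b - a)⁻¹ * ∫ t in a..b, u t ^ 2) := by gcongr
    _ = (b - a) * ∫ t in a..b, u t ^ 2 := by field_simp

theorem norm_one_sub_fourier_sq (m : ℤ) (t : ℝ) :
    ‖1 - fourier m (t : AddCircle (2 * π))‖ ^ 2 = 2 - 2 * cos (m * t) := by
  have harg : Complex.I * m * t = ((m * t : ℝ) : ℂ) * Complex.I := by push_cast; ring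
  have hpyth := sin_sq_add_cos_sq (m * t)
  rw [fourier_coe_two_pi, harg, Complex.exp_mul_I, ← Complex.ofReal_cos, ← Complex.ofReal_sin,
    ← Complex.normSq_eq_norm_sq, Complex.normSq_apply]
  simp only [Complex.sub_re, Complex.add_re, Complex.one_re, Complex.ofReal_re,
    Complex.re_ofReal_mul, Complex.I_re, Complex.sub_im, Complex.add_im, Complex.one_im,
    Complex.ofReal_im, Complex.im_ofReal_mul, Complex.I_im]
  linear_combination hpyth

theorem sq_le_norm_one_sub_fourier_one_sq {t : ℝ} (ht : |t| ≤ π) :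
    t ^ 2 ≤ π ^ 2 / 4 * ‖1 - fourier 1 (t : AddCircle (2 * π))‖ ^ 2 := by
  have hcos := cos_le_one_sub_mul_cos_sq ht
  calc t ^ 2 = π ^ 2 / 2 * (2 / π ^ 2 * t ^ 2) := by field_simp
    _ ≤ π ^ 2 / 2 * (1 - cos t) := by gcongr; linarith
    _ = _ := by rw [norm_one_sub_fourier_sq, Int.cast_one, one_mul]; ring

theorem two_le_norm_one_sub_fourier_sq {m : ℕ} (hm : 1 ≤ m) {t : ℝ}
    (ht : t ∈ Set.Icc (π / (2 * m)) (π / m)) :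
    2 ≤ ‖1 - fourier m (t : AddCircle (2 * π))‖ ^ 2 := by
  have hlower : π / 2 ≤ m * t := by
    calc π / 2 = m * (π / (2 * m)) := by field_simp
      _ ≤ m * t := by gcongr; exact ht.1
  have hupper : m * t ≤ π := by
    calc m * t ≤ m * (π / m) := by gcongr; exact ht.2
      _ = π := by field_simp
  have hcos : cos (m * t) ≤ 0 :=
    cos_nonpos_of_pi_div_two_le_of_le hlower (by linarith [pi_pos])
  rw [norm_one_sub_fourier_sq, Int.cast_natCast]
  linarith

theorem sq_mul_norm_trigPoly_le (b : ℤ →₀ ℂ) {m : ℕ} (hm : 1 ≤ m) {t : ℝ}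
    (ht : t ∈ Set.Icc (π / (2 * m)) (π / m)) :
    (t * ‖trigPoly b t‖) ^ 2 ≤ π ^ 2 / 8 * ‖trigPoly (stepDiff m (stepDiff 1 b)) t‖ ^ 2 := by
  have ht0 : 0 ≤ t := le_trans (by positivity) ht.1
  have htpi : |t| ≤ π := by
    rw [abs_of_nonneg ht0]
    exact ht.2.trans (div_le_self pi_pos.le (by exact_mod_cast hm))
  rw [trigPoly_stepDiff, trigPoly_stepDiff, ContinuousMap.mul_apply, ContinuousMap.mul_apply,
    norm_mul, norm_mul, mul_pow, mul_pow, mul_pow]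
  have h1 := sq_le_norm_one_sub_fourier_one_sq htpi
  have h2 := two_le_norm_one_sub_fourier_sq hm ht
  simp only [ContinuousMap.sub_apply, ContinuousMap.one_apply]
  calc t ^ 2 * ‖trigPoly b t‖ ^ 2
      ≤ π ^ 2 / 4 * ‖1 - fourier 1 (t : AddCircle (2 * π))‖ ^ 2 * ‖trigPoly b t‖ ^ 2 := by
        gcongr
    _ = π ^ 2 / 8 * (2 * (‖1 - fourier 1 (t : AddCircle (2 * π))‖ ^ 2 * ‖trigPoly b t‖ ^ 2)) := by
        ring
    _ ≤ _ := by gcongr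

theorem integral_annulus_sq_le (b : ℤ →₀ ℂ) {m : ℕ} (hm : 1 ≤ m) :
    (∫ t in π / (2 * m)..π / m, t * ‖trigPoly b t‖) ^ 2 ≤
      π ^ 4 / (8 * m) * ∑' k, ‖stepDiff m (stepDiff 1 b) k‖ ^ 2 := by
  have hm0 : (0 : ℝ) < m := by exact_mod_cast hm
  have hlt : π / (2 * m) < π / m := by
    gcongr
    linarith
  have hle : π / m ≤ π := div_le_self pi_pos.le (by exact_mod_cast hm)
  have hneg : -π ≤ π / (2 * m) := (neg_nonpos.2 pi_pos.le).trans (by positivity)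
  set c := stepDiff m (stepDiff 1 b)
  have hcont : Continuous fun t : ℝ => ‖trigPoly c t‖ ^ 2 := by fun_prop
  calc (∫ t in π / (2 * m)..π / m, t * ‖trigPoly b t‖) ^ 2
      ≤ (π / m - π / (2 * m)) * ∫ t in π / (2 * m)..π / m, (t * ‖trigPoly b t‖) ^ 2 :=
        sq_intervalIntegral_le (by fun_prop) hlt
    _ ≤ (π / m - π / (2 * m)) * ∫ t in π / (2 * m)..π / m, π ^ 2 / 8 * ‖trigPoly c t‖ ^ 2 := by
        refine mul_le_mul_of_nonneg_left ?_ (sub_nonneg.2 hlt.le)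
        exact intervalIntegral.integral_mono_on hlt.le
          (Continuous.intervalIntegrable (by fun_prop) _ _)
          (Continuous.intervalIntegrable (by fun_prop) _ _)
          fun t ht => sq_mul_norm_trigPoly_le b hm ht
    _ ≤ (π / m - π / (2 * m)) * (π ^ 2 / 8 * ∫ t in -π..π, ‖trigPoly c t‖ ^ 2) := by
        rw [intervalIntegral.integral_const_mul]
        gcongr
        exact intervalIntegral.integral_mono_interval hneg hlt.le hle
          (Eventually.of_forall fun t => by positivity) (hcont.intervalIntegrable _ _)
    _ = _ := by
        rw [integral_norm_sq_trigPoly]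
        field_simp
        ring

/-! ### Integration against concentrating kernels -/

section IntegrationByParts

variable {𝕜 : Type*} [RCLike 𝕜]

theorem integral_mul_integral_eq_integral_integral_mul {g h : ℝ → 𝕜} {a b : ℝ} (hab : a ≤ b)
    (hg : IntervalIntegrable g volume a b) (hh : IntervalIntegrable h volume a b) :
    ∫ t in a..b, g t * ∫ s in t..b, h s = ∫ s in a..b, (∫ t in a..s, g t) * h s := by
  rw [intervalIntegrable_iff_integrableOn_Ioc_of_le hab] at hg hh
  let F : ℝ → ℝ → 𝕜 := fun t s => {p : ℝ × ℝ | p.1 < p.2}.indicator (fun p => g p.1 * h p.2) (t, s)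
  have hF : Integrable (Function.uncurry F)
      ((volume.restrict (Set.Ioc a b)).prod (volume.restrict (Set.Ioc a b))) :=
    (hg.mul_prod hh).indicator (measurableSet_lt measurable_fst measurable_snd)
  have hleft : ∀ t ∈ Set.Ioc a b, ∫ s in Set.Ioc a b, F t s = g t * ∫ s in t..b, h s := by
    intro t ht
    have hFt : F t = (Set.Ioi t).indicator fun s => g t * h s := rfl
    rw [hFt, setIntegral_indicator measurableSet_Ioi, Set.Ioc_inter_Ioi, max_eq_right ht.1.le,
      integral_const_mul, intervalIntegral.integral_of_le ht.2]
  have hright : ∀ s ∈ Set.Ioc a b, ∫ t in Set.Ioc a b, F t s = (∫ t in a..s, g t) * h s := by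
    intro s hs
    have hFs : (fun t => F t s) = (Set.Iio s).indicator fun t => g t * h s := rfl
    have hset : Set.Ioc a b ∩ Set.Iio s = Set.Ioo a s := by
      ext x
      simp only [Set.mem_inter_iff, Set.mem_Ioc, Set.mem_Iio, Set.mem_Ioo]
      exact ⟨fun h => ⟨h.1.1, h.2⟩, fun h => ⟨⟨h.1, h.2.le.trans hs.2⟩, h.2⟩⟩
    rw [hFs, setIntegral_indicator measurableSet_Iio, hset, integral_mul_const,
      ← integral_Ioc_eq_integral_Ioo, intervalIntegral.integral_of_le hs.1.le]
  rw [intervalIntegral.integral_of_le hab, intervalIntegral.integral_of_le hab,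
    ← setIntegral_congr_fun measurableSet_Ioc hleft,
    ← setIntegral_congr_fun measurableSet_Ioc hright]
  exact integral_integral_swap hF

theorem integral_mul_eq_sub_integral_primitive_mul {g K K' : ℝ → 𝕜} {a b : ℝ} (hab : a ≤ b)
    (hg : ∀ x y, IntervalIntegrable g volume x y) (hK : ∀ t, HasDerivAt K (K' t) t)
    (hK' : Continuous K') (hKab : K a = K b) (c : ℝ) :
    ∫ t in a..b, g t * K t =
      K b * (∫ t in a..b, g t) - ∫ s in a..b, (∫ t in c..s, g t) * K' s := by
  have hKc : Continuous K := continuous_iff_continuousAt.2 fun t => (hK t).continuousAt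
  have ftc : ∀ t, ∫ s in t..b, K' s = K b - K t := fun t =>
    intervalIntegral.integral_eq_sub_of_hasDerivAt (fun x _ => hK x) (hK'.intervalIntegrable _ _)
  have hprim : Continuous fun s => ∫ t in c..s, g t := intervalIntegral.continuous_primitive hg c
  have hshift : ∫ s in a..b, (∫ t in c..s, g t) * K' s =
      ∫ s in a..b, (∫ t in a..s, g t) * K' s := by
    simp_rw [← intervalIntegral.integral_interval_sub_left (hg c _) (hg c a), sub_mul]
    rw [intervalIntegral.integral_sub (Continuous.intervalIntegrable (by fun_prop) _ _)
      (Continuous.intervalIntegrable (by fun_prop) _ _), intervalIntegral.integral_const_mul,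
      ftc, hKab, sub_self, mul_zero, sub_zero]
  rw [hshift, ← integral_mul_integral_eq_integral_integral_mul hab (hg a b)
    (hK'.intervalIntegrable a b), ← intervalIntegral.integral_const_mul,
    ← intervalIntegral.integral_sub ((hg a b).const_mul _)
      ((hg a b).mul_continuousOn (by simp_rw [ftc]; fun_prop))]
  refine intervalIntegral.integral_congr fun t _ => ?_
  simp only [ftc]
  ring

end IntegrationByParts

theorem exists_le_mul_of_isLittleO_id {H : ℝ → ℝ} (hH : Continuous H)
    (hH0 : H =o[𝓝 0] fun t => t) {b : ℝ} (hb : 0 < b) {η : ℝ} (hη : 0 < η) :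
    ∃ δ C : ℝ, 0 < δ ∧ δ ≤ b ∧ (∀ t ∈ Set.Icc 0 δ, H t ≤ η * t) ∧
      ∀ t ∈ Set.Icc δ b, H t ≤ C * t := by
  obtain ⟨r, hr, hHr⟩ := Metric.eventually_nhds_iff.1 (hH0.def hη)
  obtain ⟨B, hB⟩ := (isCompact_Icc (a := (0 : ℝ)) (b := b)).exists_bound_of_continuousOn
    hH.continuousOn
  have hB0 : 0 ≤ B := (norm_nonneg _).trans (hB 0 ⟨le_rfl, hb.le⟩)
  set δ := min (r / 2) b
  have hδ : 0 < δ := lt_min (half_pos hr) hb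
  refine ⟨δ, B / δ, hδ, min_le_right _ _, fun t ht => ?_, fun t ht => ?_⟩
  · have htr : dist t 0 < r := by
      rw [Real.dist_0_eq_abs, abs_of_nonneg ht.1]
      linarith [ht.2, min_le_left (r / 2) b]
    simpa [abs_of_nonneg ht.1] using (le_abs_self _).trans (hHr htr)
  · calc H t ≤ B := (le_abs_self _).trans (hB t ⟨hδ.le.trans ht.1, ht.2⟩)
      _ = B / δ * δ := by field_simp
      _ ≤ B / δ * t := by gcongr; exact ht.1

theorem integral_mul_le_of_le_mul {H D : ℝ → ℝ} (hH : Continuous H) (hD : Continuous D)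
    (hD0 : ∀ t, 0 ≤ D t) {δ b η C : ℝ} (hδ : 0 < δ) (hδb : δ ≤ b) (hη : 0 ≤ η)
    (hnear : ∀ t ∈ Set.Icc 0 δ, H t ≤ η * t) (hfar : ∀ t ∈ Set.Icc δ b, H t ≤ C * t) :
    ∫ t in (0 : ℝ)..b, H t * D t ≤
      η * (∫ t in (0 : ℝ)..b, t * D t) + C * ∫ t in δ..b, t * D t := by
  have hi : ∀ x y, IntervalIntegrable (fun t => H t * D t) volume x y := fun x y =>
    Continuous.intervalIntegrable (by fun_prop) _ _
  have hm : ∀ x y, IntervalIntegrable (fun t => t * D t) volume x y := fun x y =>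
    Continuous.intervalIntegrable (by fun_prop) _ _
  rw [← intervalIntegral.integral_add_adjacent_intervals (hi 0 δ) (hi δ b)]
  have hsub : ∫ t in (0 : ℝ)..δ, t * D t ≤ ∫ t in (0 : ℝ)..b, t * D t := by
    refine intervalIntegral.integral_mono_interval le_rfl hδ.le hδb ?_ (hm _ _)
    filter_upwards [ae_restrict_mem measurableSet_Ioc] with t ht
    exact mul_nonneg ht.1.le (hD0 t)
  refine add_le_add (le_trans ?_ (mul_le_mul_of_nonneg_left hsub hη)) ?_
  · rw [← intervalIntegral.integral_const_mul]
    refine intervalIntegral.integral_mono_on hδ.le (hi _ _) ((hm _ _).const_mul _) fun t ht => ?_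
    rw [← mul_assoc]
    exact mul_le_mul_of_nonneg_right (hnear t ht) (hD0 t)
  · rw [← intervalIntegral.integral_const_mul]
    refine intervalIntegral.integral_mono_on hδb (hi _ _) ((hm _ _).const_mul _) fun t ht => ?_
    rw [← mul_assoc]
    exact mul_le_mul_of_nonneg_right (hfar t ht) (hD0 t)

theorem norm_integral_mul_le_integral_add_neg {G D : ℝ → ℂ} (hG : Continuous G)
    (hD : Continuous D) (hneg : ∀ t, ‖D (-t)‖ = ‖D t‖) {b : ℝ} (hb : 0 ≤ b) :
    ‖∫ t in -b..b, G t * D t‖ ≤ ∫ t in (0 : ℝ)..b, (‖G t‖ + ‖G (-t)‖) * ‖D t‖ := by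
  have hi : ∀ x y, IntervalIntegrable (fun t => ‖G t * D t‖) volume x y := fun x y =>
    Continuous.intervalIntegrable (by fun_prop) _ _
  have hreflect : ∫ t in -b..0, ‖G t * D t‖ = ∫ t in (0 : ℝ)..b, ‖G (-t)‖ * ‖D t‖ := by
    rw [← neg_zero, ← intervalIntegral.integral_comp_neg, neg_zero]
    simp only [norm_mul, hneg]
  calc ‖∫ t in -b..b, G t * D t‖ ≤ ∫ t in -b..b, ‖G t * D t‖ :=
        intervalIntegral.norm_integral_le_integral_norm (by linarith)
    _ = (∫ t in (0 : ℝ)..b, ‖G (-t)‖ * ‖D t‖) + ∫ t in (0 : ℝ)..b, ‖G t‖ * ‖D t‖ := by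
        rw [← intervalIntegral.integral_add_adjacent_intervals (hi (-b) 0) (hi 0 b), hreflect]
        simp only [norm_mul]
    _ = _ := by
        rw [← intervalIntegral.integral_add (Continuous.intervalIntegrable (by fun_prop) _ _)
          (Continuous.intervalIntegrable (by fun_prop) _ _)]
        simp only [add_mul, add_comm]

/-- The first absolute moments of the functions `Dₙ` on `[0, π]` are bounded and concentrate at the
origin. In the applications `Dₙ` is the derivative of a summation kernel. -/
structure HasConcentratingMoments (D : ℕ → ℝ → ℂ) : Prop where
  continuous : ∀ n, Continuous (D n)
  norm_neg : ∀ n t, ‖D n (-t)‖ = ‖D n t‖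
  exists_moment_le : ∃ A, ∀ n, ∫ t in (0 : ℝ)..π, t * ‖D n t‖ ≤ A
  tendsto_moment_tail : ∀ δ, 0 < δ → δ ≤ π →
    Tendsto (fun n => ∫ t in δ..π, t * ‖D n t‖) atTop (𝓝 0)

theorem HasConcentratingMoments.tendsto_integral_mul {D : ℕ → ℝ → ℂ}
    (hD : HasConcentratingMoments D) {G : ℝ → ℂ} (hG : Continuous G) (hG0 : G 0 = 0)
    (hG' : HasDerivAt G 0 0) :
    Tendsto (fun n => ∫ t in -π..π, G t * D n t) atTop (𝓝 0) := by
  obtain ⟨A, hA⟩ := hD.exists_moment_le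
  have hA0 : 0 ≤ A := le_trans (intervalIntegral.integral_nonneg pi_pos.le fun t ht =>
    mul_nonneg ht.1 (norm_nonneg _)) (hA 0)
  have hGo : G =o[𝓝 0] fun t : ℝ => t := by
    simpa [hG0] using hasDerivAt_iff_isLittleO_nhds_zero.1 hG'
  have hGo_neg : (fun t => G (-t)) =o[𝓝 0] fun t : ℝ => t := by
    simpa [Function.comp_def] using
      (hGo.comp_tendsto (continuous_neg.tendsto' (0 : ℝ) 0 neg_zero)).neg_right
  rw [Metric.tendsto_nhds]
  intro ε hε
  obtain ⟨δ, C, hδ, hδpi, hnear, hfar⟩ := exists_le_mul_of_isLittleO_id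
    (by fun_prop) (hGo.norm_left.add hGo_neg.norm_left) pi_pos (η := ε / (2 * (A + 1)))
    (by positivity)
  have htail := (hD.tendsto_moment_tail δ hδ hδpi).const_mul C
  rw [mul_zero] at htail
  filter_upwards [htail.eventually (gt_mem_nhds (half_pos hε))] with n hn
  have hDn := hD.continuous n
  rw [dist_zero_right]
  calc ‖∫ t in -π..π, G t * D n t‖
      ≤ ∫ t in (0 : ℝ)..π, (‖G t‖ + ‖G (-t)‖) * ‖D n t‖ :=
        norm_integral_mul_le_integral_add_neg hG hDn (hD.norm_neg n) pi_pos.le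
    _ ≤ ε / (2 * (A + 1)) * (∫ t in (0 : ℝ)..π, t * ‖D n t‖) + C * ∫ t in δ..π, t * ‖D n t‖ :=
        integral_mul_le_of_le_mul (by fun_prop) hDn.norm (fun t => norm_nonneg _) hδ hδpi
          (by positivity) hnear hfar
    _ < ε / (2 * (A + 1)) * (A + 1) + ε / 2 := by
        refine add_lt_add_of_le_of_lt (mul_le_mul_of_nonneg_left ?_ (by positivity)) hn
        linarith [hA n]
    _ = ε := by field_simp; ring

theorem integral_one_sub_cos : ∫ t in -π..π, (1 - Complex.cos t) = 2 * π := by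
  have hcos : ∫ t in -π..π, Complex.cos t = 0 := by
    simp_rw [← Complex.ofReal_cos, intervalIntegral.integral_ofReal, integral_cos]
    simp
  rw [intervalIntegral.integral_sub (by simp) (Continuous.intervalIntegrable (by fun_prop) _ _),
    hcos]
  simp
  ring

/-- Integrating by parts against `Kₙ` leaves the boundary term `Kₙ(π) ∫ g`. Testing with
`1 - cos t`, for which the left-hand side is a quantity tending to zero by `hcos`, shows that
`Kₙ(π) → 0`. -/
theorem HasConcentratingMoments.tendsto_integral_mul_kernel {K D : ℕ → ℝ → ℂ}
    (hD : HasConcentratingMoments D) (hK : ∀ n t, HasDerivAt (K n) (D n t) t)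
    (hKpi : ∀ n, K n (-π) = K n π)
    (hcos : Tendsto (fun n => ∫ t in -π..π, (1 - Complex.cos t) * K n t) atTop (𝓝 0))
    {g : ℝ → ℂ} (hg : ∀ x y, IntervalIntegrable g volume x y)
    (hg' : HasDerivAt (fun y => ∫ t in (0 : ℝ)..y, g t) 0 0) :
    Tendsto (fun n => ∫ t in -π..π, g t * K n t) atTop (𝓝 0) := by
  have boundary : ∀ {g : ℝ → ℂ}, (∀ x y, IntervalIntegrable g volume x y) →
      HasDerivAt (fun y => ∫ t in (0 : ℝ)..y, g t) 0 0 →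
      Tendsto (fun n => K n π * (∫ t in -π..π, g t) - ∫ t in -π..π, g t * K n t)
        atTop (𝓝 0) := by
    intro g hg hg'
    refine (hD.tendsto_integral_mul (intervalIntegral.continuous_primitive hg 0) (by simp)
      hg').congr fun n => ?_
    rw [integral_mul_eq_sub_integral_primitive_mul (by linarith [pi_pos]) hg (hK n)
      (hD.continuous n) (hKpi n) 0]
    ring
  have hKlim : Tendsto (fun n => K n π) atTop (𝓝 0) := by
    have hc : Continuous fun t : ℝ => 1 - Complex.cos t := by fun_prop
    have htest := boundary (g := fun t => 1 - Complex.cos t) (fun x y => hc.intervalIntegrable x y)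
      (by simpa using (hc.integral_hasStrictDerivAt 0 0).hasDerivAt)
    have hpi : (π : ℂ) ≠ 0 := by exact_mod_cast pi_ne_zero
    have hlim := (htest.add hcos).mul_const (2 * π : ℂ)⁻¹
    simp only [integral_one_sub_cos, sub_add_cancel, add_zero, zero_mul] at hlim
    exact hlim.congr fun n => by field_simp
  have hlim := (hKlim.mul_const (∫ t in -π..π, g t)).sub (boundary hg hg')
  simpa only [sub_sub_cancel, zero_mul, sub_zero] using hlim

/-! ### Kernels of multiplier means -/

theorem norm_trigPoly_apply_le {b : ℤ →₀ ℂ} {s : Finset ℤ} (hs : b.support ⊆ s) {C : ℝ}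
    (hb : ∀ k, ‖b k‖ ≤ C) (x : AddCircle (2 * π)) : ‖trigPoly b x‖ ≤ s.card * C := by
  have hC : 0 ≤ C := (norm_nonneg _).trans (hb 0)
  calc ‖trigPoly b x‖ ≤ ∑ _k ∈ b.support, C := by
        rw [trigPoly_apply]
        refine norm_sum_le_of_le _ fun k _ => ?_
        rw [norm_mul, norm_fourier_apply, mul_one]
        exact hb k
    _ ≤ ∑ _k ∈ s, C := Finset.sum_le_sum_of_subset_of_nonneg hs fun _ _ _ => hC
    _ = s.card * C := by rw [Finset.sum_const, nsmul_eq_mul]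

theorem norm_trigPoly_neg {b : ℤ →₀ ℂ} (hb : ∀ k, starRingEnd ℂ (b k) = -b k)
    (x : AddCircle (2 * π)) : ‖trigPoly b (-x)‖ = ‖trigPoly b x‖ := by
  have hconj : trigPoly b (-x) = -starRingEnd ℂ (trigPoly b x) := by
    simp only [trigPoly_apply, map_sum, map_mul, hb, ← fourier_neg, neg_mul,
      Finset.sum_neg_distrib, neg_neg]
    simp only [fourier_apply, smul_neg, neg_smul]
  rw [hconj, norm_neg, RCLike.norm_conj]

theorem intervalIntegral_fourier_mul_trigPoly (b : ℤ →₀ ℂ) (k : ℤ) :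
    ∫ t in -π..π, fourier k (t : AddCircle (2 * π)) * trigPoly b t = 2 * π * b (-k) := by
  have hpi : (π : ℂ) ≠ 0 := by exact_mod_cast pi_ne_zero
  have h := fourierCoeff_eq_intervalIntegral (trigPoly b) (-k) (-π)
  rw [fourierCoeff_trigPoly, show -π + 2 * π = π by ring, neg_neg, Complex.real_smul] at h
  simp only [smul_eq_mul] at h
  rw [h]
  push_cast
  field_simp

/-- The Fourier coefficients `φ(k / (n + 1))` of the kernel of the `n`-th mean generated by `φ`,
cut off at `|k| ≤ n`, which changes nothing if `φ` vanishes outside `(-1, 1)`. -/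
def multiplierCoeff (φ : ℝ → ℝ) (n : ℕ) : ℤ →₀ ℂ :=
  Finsupp.indicator (Finset.Icc (-(n : ℤ)) n) fun k _ => (φ ((k : ℝ) / ((n : ℝ) + 1)) : ℂ)

theorem one_le_abs_div_of_notMem_Icc {n : ℕ} {k : ℤ} (hk : k ∉ Finset.Icc (-(n : ℤ)) n) :
    1 ≤ |(k : ℝ) / ((n : ℝ) + 1)| := by
  have hn : (0 : ℝ) < (n : ℝ) + 1 := by positivity
  have habs : (n : ℤ) + 1 ≤ |k| := by
    rw [Finset.mem_Icc, ← abs_le] at hk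
    omega
  rw [abs_div, abs_of_pos hn, one_le_div hn]
  exact_mod_cast habs

theorem multiplierCoeff_apply {φ : ℝ → ℝ} (hφ : ∀ x, 1 ≤ |x| → φ x = 0) (n : ℕ) (k : ℤ) :
    multiplierCoeff φ n k = φ ((k : ℝ) / ((n : ℝ) + 1)) := by
  rw [multiplierCoeff, Finsupp.indicator_apply]
  split_ifs with hk
  · rfl
  · rw [hφ _ (one_le_abs_div_of_notMem_Icc hk), Complex.ofReal_zero]

theorem support_multiplierCoeff_subset (φ : ℝ → ℝ) (n : ℕ) :
    (multiplierCoeff φ n).support ⊆ Finset.Icc (-(n : ℤ)) n :=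
  Finsupp.support_indicator_subset _ _

theorem multiplierMean_eq_integral_haarAddCircle {φ : ℝ → ℝ} (hφ : ∀ x, 1 ≤ |x| → φ x = 0)
    {f : AddCircle (2 * π) → ℂ} (hf : Integrable f AddCircle.haarAddCircle) (n : ℕ) (x : ℝ) :
    multiplierMean φ f n x =
      ∫ y, f ((x : AddCircle (2 * π)) - y) * trigPoly (multiplierCoeff φ n) y
        ∂AddCircle.haarAddCircle := by
  have hcoeff : ∀ k : ℤ, fourierCoeff f k * fourier k (x : AddCircle (2 * π)) =
      ∫ y, f ((x : AddCircle (2 * π)) - y) * fourier k y ∂AddCircle.haarAddCircle := by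
    intro k
    rw [fourierCoeff, ← integral_sub_left_eq_self _ _ (x : AddCircle (2 * π)),
      ← integral_mul_const]
    refine integral_congr_ae (.of_forall fun y => ?_)
    have hsplit : fourier (-k) ((x : AddCircle (2 * π)) - y) *
        fourier k (x : AddCircle (2 * π)) = fourier k y := by
      simp only [fourier_apply, ← Circle.coe_mul, ← AddCircle.toCircle_add]
      congr 2
      rw [neg_smul, smul_sub]
      abel
    simp only [smul_eq_mul]
    rw [← hsplit]
    ring
  have hint : ∀ k : ℤ, Integrable (fun y => f ((x : AddCircle (2 * π)) - y) * fourier k y)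
      AddCircle.haarAddCircle :=
    fun k => (hf.comp_sub_left _).mul_bdd (c := 1) (map_continuous _).aestronglyMeasurable
      (.of_forall fun y => by rw [norm_fourier_apply])
  have hsum : multiplierMean φ f n x = ∑ k ∈ (multiplierCoeff φ n).support,
      multiplierCoeff φ n k * (fourierCoeff f k * fourier k (x : AddCircle (2 * π))) := by
    simp only [multiplierMean, ← multiplierCoeff_apply hφ, fourier_coe_two_pi, ← mul_assoc]
    refine tsum_eq_sum fun k hk => ?_
    rw [Finsupp.notMem_support_iff.1 hk, zero_mul, zero_mul]
  simp only [hsum, hcoeff, ← integral_const_mul]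
  rw [← integral_finsetSum _ fun k _ => (hint k).const_mul _]
  refine integral_congr_ae (.of_forall fun y => ?_)
  simp only [trigPoly_apply, Finset.mul_sum]
  exact Finset.sum_congr rfl fun k _ => by ring

theorem multiplierMean_eq_intervalIntegral {φ : ℝ → ℝ} (hφ : ∀ x, 1 ≤ |x| → φ x = 0)
    {f : AddCircle (2 * π) → ℂ} (hf : Integrable f AddCircle.haarAddCircle) (n : ℕ) (x : ℝ) :
    multiplierMean φ f n x = (2 * π : ℂ)⁻¹ *
      ∫ t in -π..π, f ((x - t : ℝ) : AddCircle (2 * π)) * trigPoly (multiplierCoeff φ n) t := by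
  rw [multiplierMean_eq_integral_haarAddCircle hφ hf,
    integral_haarAddCircle_eq_intervalIntegral _ (-π), show -π + 2 * π = π by ring,
    Complex.real_smul]
  push_cast
  rfl

theorem intervalIntegral_multiplierCoeff {φ : ℝ → ℝ} (hφ : ∀ x, 1 ≤ |x| → φ x = 0)
    (h0 : φ 0 = 1) (n : ℕ) :
    ∫ t in -π..π, trigPoly (multiplierCoeff φ n) (t : AddCircle (2 * π)) = 2 * π := by
  simpa [multiplierCoeff_apply hφ, h0] using
    intervalIntegral_fourier_mul_trigPoly (multiplierCoeff φ n) 0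

theorem intervalIntegral_one_sub_cos_mul_trigPoly (b : ℤ →₀ ℂ) :
    ∫ t in -π..π, (1 - Complex.cos t) * trigPoly b (t : AddCircle (2 * π)) =
      2 * π * b 0 - π * (b (-1) + b 1) := by
  have hexp : ∀ t : ℝ, (1 - Complex.cos t) * trigPoly b t =
      fourier 0 (t : AddCircle (2 * π)) * trigPoly b t -
        (1 / 2 : ℂ) * (fourier 1 (t : AddCircle (2 * π)) * trigPoly b t +
          fourier (-1) (t : AddCircle (2 * π)) * trigPoly b t) := by
    intro t
    simp only [fourier_coe_two_pi, Complex.cos]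
    push_cast
    simp only [mul_zero, zero_mul, Complex.exp_zero]
    ring_nf
  have hi : ∀ k : ℤ, IntervalIntegrable (fun t : ℝ => fourier k (t : AddCircle (2 * π)) *
      trigPoly b t) volume (-π) π := fun k =>
    Continuous.intervalIntegrable (by fun_prop) _ _
  simp only [hexp]
  rw [intervalIntegral.integral_sub (hi 0) (((hi 1).add (hi (-1))).const_mul _),
    intervalIntegral.integral_const_mul, intervalIntegral.integral_add (hi 1) (hi (-1))]
  simp only [intervalIntegral_fourier_mul_trigPoly, neg_zero, neg_neg]
  ring

theorem tendsto_integral_one_sub_cos_mul_multiplierCoeff {φ : ℝ → ℝ}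
    (hφ : ∀ x, 1 ≤ |x| → φ x = 0) (hc : ContinuousAt φ 0) :
    Tendsto (fun n => ∫ t in -π..π,
      (1 - Complex.cos t) * trigPoly (multiplierCoeff φ n) (t : AddCircle (2 * π)))
      atTop (𝓝 0) := by
  simp only [intervalIntegral_one_sub_cos_mul_trigPoly, multiplierCoeff_apply hφ]
  have hcoeff : ∀ k : ℤ, Tendsto (fun n : ℕ => (φ ((k : ℝ) / ((n : ℝ) + 1)) : ℂ)) atTop
      (𝓝 (φ 0)) := fun k => by
    have hk : Tendsto (fun n : ℕ => (k : ℝ) / ((n : ℝ) + 1)) atTop (𝓝 0) :=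
      tendsto_const_nhds.div_atTop
        (tendsto_atTop_add_const_right _ _ tendsto_natCast_atTop_atTop)
    exact (Complex.continuous_ofReal.tendsto _).comp (hc.tendsto.comp hk)
  have hlim := ((hcoeff 0).const_mul (2 * π : ℂ)).sub
    (((hcoeff (-1)).add (hcoeff 1)).const_mul (π : ℂ))
  rwa [← two_mul, mul_left_comm, ← mul_assoc, sub_self] at hlim

theorem integral_dyadic_eq_sum {u : ℝ → ℝ} (hu : Continuous u) (J : ℕ) :
    ∫ t in π / 2 ^ J..π, u t =
      ∑ j ∈ Finset.range J, ∫ t in π / (2 * (2 ^ j : ℕ))..π / (2 ^ j : ℕ), u t := by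
  induction J with
  | zero => simp
  | succ J ih =>
    rw [Finset.sum_range_succ, ← ih, pow_succ', add_comm]
    push_cast
    exact (intervalIntegral.integral_add_adjacent_intervals (hu.intervalIntegrable _ _)
      (hu.intervalIntegrable _ _)).symm

theorem sum_range_two_pow_div_rpow_le {N E : ℝ} (hE : 0 < E) {J : ℕ} (hJ : 2 ^ J ≤ N) :
    ∑ j ∈ Finset.range (J + 1), (((2 ^ j : ℕ) : ℝ) / N) ^ E ≤ 2 ^ E / (2 ^ E - 1) := by
  have hN : 0 < N := lt_of_lt_of_le (by positivity) hJ
  have hr : (1 : ℝ) < 2 ^ E := one_lt_rpow one_lt_two hE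
  have hpow : ∀ j : ℕ, ((2 : ℝ) ^ j) ^ E = (2 ^ E) ^ j := fun j => by
    rw [← rpow_natCast, ← rpow_natCast, ← rpow_mul two_pos.le, ← rpow_mul two_pos.le, mul_comm]
  have hlast : ((2 : ℝ) ^ E) ^ J ≤ N ^ E := by
    rw [← hpow]
    exact rpow_le_rpow (by positivity) hJ hE.le
  calc ∑ j ∈ Finset.range (J + 1), (((2 ^ j : ℕ) : ℝ) / N) ^ E
      = (∑ j ∈ Finset.range (J + 1), ((2 : ℝ) ^ E) ^ j) / N ^ E := by
        rw [Finset.sum_div]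
        refine Finset.sum_congr rfl fun j _ => ?_
        rw [div_rpow (by positivity) hN.le, Nat.cast_pow, Nat.cast_ofNat, hpow]
    _ = ((2 : ℝ) ^ E * (2 ^ E) ^ J - 1) / (2 ^ E - 1) / N ^ E := by
        rw [geom_sum_eq hr.ne', pow_succ']
    _ ≤ (2 : ℝ) ^ E * N ^ E / (2 ^ E - 1) / N ^ E := by
        have : 0 < (2 : ℝ) ^ E - 1 := sub_pos.2 hr
        gcongr
        exact (sub_le_self _ zero_le_one).trans (by gcongr)
    _ = 2 ^ E / (2 ^ E - 1) := by field_simp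

theorem integral_le_of_dyadic_le {u : ℝ → ℝ} (hu : Continuous u) {N S C E : ℝ} (hN : 1 ≤ N)
    (hS0 : 0 ≤ S) (hC : 0 ≤ C) (hE : 0 < E) (hS : ∀ t ∈ Set.Icc 0 (π / N), u t ≤ S)
    (hdyadic : ∀ m : ℕ, 1 ≤ m → ∫ t in π / (2 * m)..π / m, u t ≤ C * (m / N) ^ E) :
    ∫ t in (0 : ℝ)..π, u t ≤ π / N * S + C * (2 ^ E / (2 ^ E - 1)) := by
  obtain ⟨J, hJN, hNJ⟩ := exists_nat_pow_near hN one_lt_two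
  have hle : π / 2 ^ (J + 1) ≤ π / N := div_le_div_of_nonneg_left pi_pos.le (by linarith) hNJ.le
  have hnear : ∫ t in (0 : ℝ)..π / 2 ^ (J + 1), u t ≤ π / N * S := by
    calc ∫ t in (0 : ℝ)..π / 2 ^ (J + 1), u t
        ≤ ∫ _t in (0 : ℝ)..π / 2 ^ (J + 1), S :=
          intervalIntegral.integral_mono_on (by positivity) (hu.intervalIntegrable _ _) (by simp)
            fun t ht => hS t ⟨ht.1, ht.2.trans hle⟩
      _ = π / 2 ^ (J + 1) * S := by simp
      _ ≤ π / N * S := by gcongr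
  have hfar : ∫ t in π / 2 ^ (J + 1)..π, u t ≤ C * (2 ^ E / (2 ^ E - 1)) := by
    calc ∫ t in π / 2 ^ (J + 1)..π, u t
        ≤ ∑ j ∈ Finset.range (J + 1), C * (((2 ^ j : ℕ) : ℝ) / N) ^ E := by
          rw [integral_dyadic_eq_sum hu]
          exact Finset.sum_le_sum fun j _ => hdyadic _ Nat.one_le_two_pow
      _ ≤ C * (2 ^ E / (2 ^ E - 1)) := by
          rw [← Finset.mul_sum]
          exact mul_le_mul_of_nonneg_left (sum_range_two_pow_div_rpow_le hE hJN) hC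
  rw [← intervalIntegral.integral_add_adjacent_intervals (hu.intervalIntegrable _ _)
    (hu.intervalIntegrable _ _)]
  exact add_le_add hnear hfar

theorem tendsto_integral_of_dyadic_le {u : ℕ → ℝ → ℝ} (hu : ∀ n, Continuous (u n))
    (hu0 : ∀ n t, 0 ≤ t → 0 ≤ u n t) {C E : ℝ} (hE : 0 < E)
    (hdyadic : ∀ n m : ℕ, 1 ≤ m →
      ∫ t in π / (2 * m)..π / m, u n t ≤ C * ((m : ℝ) / ((n : ℝ) + 1)) ^ E)
    {δ : ℝ} (hδ : 0 < δ) (hδpi : δ ≤ π) :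
    Tendsto (fun n => ∫ t in δ..π, u n t) atTop (𝓝 0) := by
  obtain ⟨J, hJ⟩ := pow_unbounded_of_one_lt (π / δ) (one_lt_two : (1 : ℝ) < 2)
  have hJδ : π / 2 ^ J ≤ δ := by
    rw [div_lt_iff₀ hδ] at hJ
    rw [div_le_iff₀ (by positivity)]
    linarith
  have hlim : Tendsto (fun n : ℕ => ∑ j ∈ Finset.range J,
      C * (((2 ^ j : ℕ) : ℝ) / ((n : ℝ) + 1)) ^ E) atTop (𝓝 0) := by
    have hterm : ∀ j ∈ Finset.range J,
        Tendsto (fun n : ℕ => C * (((2 ^ j : ℕ) : ℝ) / ((n : ℝ) + 1)) ^ E) atTop (𝓝 0) := by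
      intro j _
      have hdiv : Tendsto (fun n : ℕ => ((2 ^ j : ℕ) : ℝ) / ((n : ℝ) + 1)) atTop (𝓝 0) :=
        tendsto_const_nhds.div_atTop
          (tendsto_atTop_add_const_right _ _ tendsto_natCast_atTop_atTop)
      simpa [zero_rpow hE.ne'] using (hdiv.rpow_const (Or.inr hE.le)).const_mul C
    simpa using tendsto_finsetSum _ hterm
  refine squeeze_zero (fun n => intervalIntegral.integral_nonneg hδpi fun t ht =>
    hu0 n t (hδ.le.trans ht.1)) (fun n => ?_) hlim
  calc ∫ t in δ..π, u n t ≤ ∫ t in π / 2 ^ J..π, u n t := by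
        refine intervalIntegral.integral_mono_interval hJδ hδpi le_rfl ?_
          ((hu n).intervalIntegrable _ _)
        filter_upwards [ae_restrict_mem measurableSet_Ioc] with t ht
        exact hu0 n t (le_trans (by positivity) ht.1.le)
    _ ≤ _ := by
        rw [integral_dyadic_eq_sum (hu n)]
        exact Finset.sum_le_sum fun j _ => hdyadic n _ Nat.one_le_two_pow

/-! ### Regular multipliers -/

open scoped NNReal

/-- `φ` is a multiplier supported in `[-1, 1]` such that `x ↦ x φ x` has a derivative `ψ` which is
Hölder continuous and Lipschitz continuous in `L¹`. These conditions suffice for the means generated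
by `φ` to converge at every `d`-point; `ψ` enters through its primitive `x φ x`. -/
structure IsRegularMultiplier (φ ψ : ℝ → ℝ) : Prop where
  map_zero : φ 0 = 1
  eq_zero : ∀ x, 1 ≤ |x| → φ x = 0
  continuous : Continuous φ
  mul_sub_mul_eq_integral : ∀ a b, b * φ b - a * φ a = ∫ x in a..b, ψ x
  exists_holderWith : ∃ C r : ℝ≥0, 0 < r ∧ HolderWith C r ψ
  integrable : Integrable ψ
  exists_integral_abs_sub_le : ∃ C, ∀ s, 0 ≤ s → ∫ x, |ψ x - ψ (x - s)| ≤ C * s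

/-- The Fourier coefficients `i k φ(k / (n + 1))` of the derivative of the kernel of the `n`-th mean
generated by `φ`. -/
def multiplierDerivCoeff (φ : ℝ → ℝ) (n : ℕ) : ℤ →₀ ℂ :=
  (fun k : ℤ => Complex.I * k) • multiplierCoeff φ n

theorem tsum_sq_le_of_le_intervalIntegral {d : ℤ → ℝ} {W : ℝ → ℝ} {S : ℝ} (hW : Continuous W)
    (hWi : Integrable W) (hWS : ∀ y, W y ≤ S) (hd0 : ∀ k, 0 ≤ d k)
    (hd : ∀ k : ℤ, d k ≤ ∫ y in (k : ℝ) - 1..k, W y) :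
    ∑' k, d k ^ 2 ≤ S * ∫ y, W y := by
  have hdS : ∀ k, d k ≤ S := fun k => by
    have h := intervalIntegral.integral_mono_on (μ := volume) (a := (k : ℝ) - 1) (b := k)
      (by linarith) (hW.intervalIntegrable _ _) (continuous_const.intervalIntegrable _ _)
      fun y _ => hWS y
    rw [intervalIntegral.integral_const, sub_sub_cancel, one_smul] at h
    exact (hd k).trans h
  have hS : 0 ≤ S := (hd0 0).trans (hdS 0)
  have hsum : HasSum (fun k : ℤ => ∫ y in (k : ℝ) - 1..k, W y) (∫ y, W y) := by
    simpa [neg_add_eq_sub] using hWi.hasSum_intervalIntegral (-1)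
  have hds : Summable d := .of_nonneg_of_le hd0 hd hsum.summable
  have hsq : ∀ k, d k ^ 2 ≤ S * d k := fun k => by
    rw [sq]
    exact mul_le_mul_of_nonneg_right (hdS k) (hd0 k)
  calc ∑' k, d k ^ 2 ≤ ∑' k, S * d k :=
        (Summable.of_nonneg_of_le (fun k => sq_nonneg _) hsq (hds.mul_left S)).tsum_le_tsum hsq
          (hds.mul_left S)
    _ = S * ∑' k, d k := tsum_mul_left
    _ ≤ S * ∫ y, W y := by
        gcongr
        exact (hds.tsum_le_tsum hd hsum.summable).trans_eq hsum.tsum_eq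

namespace IsRegularMultiplier

variable {φ ψ : ℝ → ℝ}

theorem continuous_deriv (h : IsRegularMultiplier φ ψ) : Continuous ψ := by
  obtain ⟨C, r, hr, hψ⟩ := h.exists_holderWith
  exact hψ.continuous hr

theorem exists_abs_le (h : IsRegularMultiplier φ ψ) : ∃ B, ∀ x, |φ x| ≤ B := by
  have hsupp : HasCompactSupport φ :=
    .of_support_subset_isCompact (isCompact_Icc (a := (-1 : ℝ)) (b := 1)) fun x hx => by
      by_contra hcon
      exact hx (h.eq_zero x (not_le.1 fun hle => hcon (abs_le.1 hle)).le)
  exact hsupp.exists_bound_of_continuous h.continuous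

theorem multiplierDerivCoeff_apply (h : IsRegularMultiplier φ ψ) (n : ℕ) (k : ℤ) :
    multiplierDerivCoeff φ n k = Complex.I * (k * φ ((k : ℝ) / ((n : ℝ) + 1)) : ℝ) := by
  rw [multiplierDerivCoeff, Finsupp.coe_pointwise_smul, Pi.smul_apply', smul_eq_mul,
    multiplierCoeff_apply h.eq_zero]
  push_cast
  ring

theorem mul_div_sub_mul_div_eq_integral (h : IsRegularMultiplier φ ψ) {N : ℝ} (hN : N ≠ 0)
    (a b : ℝ) : b * φ (b / N) - a * φ (a / N) = ∫ y in a..b, ψ (y / N) := by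
  rw [intervalIntegral.integral_comp_div _ hN, ← h.mul_sub_mul_eq_integral, smul_eq_mul]
  field_simp

theorem norm_stepDiff_multiplierDerivCoeff (h : IsRegularMultiplier φ ψ) (n m : ℕ) (k : ℤ) :
    ‖stepDiff m (stepDiff 1 (multiplierDerivCoeff φ n)) k‖ =
      |∫ y in (k : ℝ) - 1..k, (ψ (y / ((n : ℝ) + 1)) - ψ ((y - m) / ((n : ℝ) + 1)))| := by
  have hN : (n : ℝ) + 1 ≠ 0 := by positivity
  have hψ := h.continuous_deriv
  rw [intervalIntegral.integral_sub (Continuous.intervalIntegrable (by fun_prop) _ _)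
      (Continuous.intervalIntegrable (by fun_prop) _ _),
    intervalIntegral.integral_comp_sub_right (fun y => ψ (y / ((n : ℝ) + 1))),
    ← h.mul_div_sub_mul_div_eq_integral hN, ← h.mul_div_sub_mul_div_eq_integral hN]
  simp only [stepDiff_apply, h.multiplierDerivCoeff_apply]
  rw [← mul_sub, ← mul_sub, ← mul_sub, norm_mul, Complex.norm_I, one_mul, ← Complex.ofReal_sub,
    ← Complex.ofReal_sub, ← Complex.ofReal_sub, Complex.norm_real, Real.norm_eq_abs]
  push_cast
  rw [sub_right_comm (k : ℝ) 1 (m : ℝ)]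

theorem exists_tsum_sq_stepDiff_le (h : IsRegularMultiplier φ ψ) :
    ∃ C E : ℝ, 0 ≤ C ∧ 0 < E ∧ ∀ n m : ℕ,
      ∑' k, ‖stepDiff m (stepDiff 1 (multiplierDerivCoeff φ n)) k‖ ^ 2 ≤
        C * m * ((m : ℝ) / ((n : ℝ) + 1)) ^ E := by
  obtain ⟨H, r, hr, hψ⟩ := h.exists_holderWith
  obtain ⟨A, hA⟩ := h.exists_integral_abs_sub_le
  have hψc := h.continuous_deriv
  have hA0 : 0 ≤ A := by
    simpa using (integral_nonneg fun x => abs_nonneg (ψ x - ψ (x - 1))).trans (hA 1 zero_le_one)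
  refine ⟨H * A, r, by positivity, hr, fun n m => ?_⟩
  set N : ℝ := (n : ℝ) + 1
  have hN : 0 < N := by positivity
  have hshift : ∀ y, (y - m) / N = y / N - m / N := fun y => sub_div _ _ _
  have hsup : ∀ y, |ψ (y / N) - ψ ((y - m) / N)| ≤ H * (m / N) ^ (r : ℝ) := fun y => by
    have hm : dist (y / N) ((y - m) / N) = m / N := by
      rw [dist_eq, hshift, sub_sub_cancel, abs_of_nonneg (by positivity)]
    rw [← hm, ← dist_eq]
    exact hψ.dist_le _ _
  have hint : ∫ y, |ψ (y / N) - ψ ((y - m) / N)| ≤ A * m := by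
    simp only [hshift]
    rw [Measure.integral_comp_div (fun x => |ψ x - ψ (x - m / N)|), abs_of_pos hN, smul_eq_mul]
    calc N * ∫ x, |ψ x - ψ (x - m / N)| ≤ N * (A * (m / N)) := by
          gcongr
          exact hA _ (by positivity)
      _ = A * m := by field_simp
  have hintegrable : Integrable fun y => |ψ (y / N) - ψ ((y - m) / N)| :=
    ((h.integrable.comp_div hN.ne').sub ((h.integrable.comp_div hN.ne').comp_sub_right m)).abs
  calc _ ≤ H * (m / N) ^ (r : ℝ) * ∫ y, |ψ (y / N) - ψ ((y - m) / N)| := by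
        refine tsum_sq_le_of_le_intervalIntegral (by fun_prop) hintegrable hsup
          (fun k => norm_nonneg _) fun k => ?_
        rw [h.norm_stepDiff_multiplierDerivCoeff]
        exact intervalIntegral.abs_integral_le_integral_abs (by linarith)
    _ ≤ H * (m / N) ^ (r : ℝ) * (A * m) := by gcongr
    _ = H * A * m * (m / N) ^ (r : ℝ) := by ring

theorem exists_integral_annulus_le (h : IsRegularMultiplier φ ψ) :
    ∃ C E : ℝ, 0 ≤ C ∧ 0 < E ∧ ∀ n m : ℕ, 1 ≤ m →
      ∫ t in π / (2 * m)..π / m, t * ‖trigPoly (multiplierDerivCoeff φ n) t‖ ≤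
        C * ((m : ℝ) / ((n : ℝ) + 1)) ^ E := by
  obtain ⟨C, E, hC, hE, hsum⟩ := h.exists_tsum_sq_stepDiff_le
  refine ⟨√(π ^ 4 / 8 * C), E / 2, by positivity, by positivity, fun n m hm => ?_⟩
  have hsqrt : (((m : ℝ) / ((n : ℝ) + 1)) ^ (E / 2)) ^ 2 = ((m : ℝ) / ((n : ℝ) + 1)) ^ E := by
    rw [← rpow_mul_natCast (by positivity), Nat.cast_ofNat, div_mul_cancel₀ _ two_ne_zero]
  refine le_of_abs_le (abs_le_of_sq_le_sq ?_ (by positivity))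
  calc _ ≤ π ^ 4 / (8 * m) * ∑' k, ‖stepDiff m (stepDiff 1 (multiplierDerivCoeff φ n)) k‖ ^ 2 :=
        integral_annulus_sq_le _ hm
    _ ≤ π ^ 4 / (8 * m) * (C * m * ((m : ℝ) / ((n : ℝ) + 1)) ^ E) := by
        gcongr
        exact hsum n m
    _ = (√(π ^ 4 / 8 * C) * ((m : ℝ) / ((n : ℝ) + 1)) ^ (E / 2)) ^ 2 := by
        rw [mul_pow, sq_sqrt (by positivity), hsqrt]
        field_simp

theorem exists_norm_trigPoly_multiplierDerivCoeff_le (h : IsRegularMultiplier φ ψ) :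
    ∃ C, 0 ≤ C ∧ ∀ (n : ℕ) (x : AddCircle (2 * π)),
      ‖trigPoly (multiplierDerivCoeff φ n) x‖ ≤ C * ((n : ℝ) + 1) ^ 2 := by
  obtain ⟨B, hB⟩ := h.exists_abs_le
  have hB0 : 0 ≤ B := (abs_nonneg _).trans (hB 0)
  refine ⟨2 * B, by positivity, fun n x => ?_⟩
  have hsupp : (multiplierDerivCoeff φ n).support ⊆ Finset.Icc (-(n : ℤ)) n := by
    refine Finset.Subset.trans (fun k hk => ?_) (support_multiplierCoeff_subset φ n)
    rw [Finsupp.mem_support_iff] at hk ⊢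
    exact right_ne_zero_of_mul hk
  have hcoeff : ∀ k, ‖multiplierDerivCoeff φ n k‖ ≤ n * B := fun k => by
    by_cases hk : k ∈ Finset.Icc (-(n : ℤ)) n
    · have hkn : |(k : ℝ)| ≤ n := by exact_mod_cast abs_le.2 (Finset.mem_Icc.1 hk)
      rw [h.multiplierDerivCoeff_apply, norm_mul, Complex.norm_I, one_mul, Complex.norm_real,
        norm_mul]
      exact mul_le_mul hkn (hB _) (norm_nonneg _) (by positivity)
    · rw [Finsupp.notMem_support_iff.1 fun hmem => hk (hsupp hmem), norm_zero]
      positivity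
  calc _ ≤ ((Finset.Icc (-(n : ℤ)) n).card : ℝ) * (n * B) := norm_trigPoly_apply_le hsupp hcoeff x
    _ = (2 * n + 1) * (n * B) := by
        rw [Int.card_Icc, show ((n : ℤ) + 1 - -n).toNat = 2 * n + 1 by omega]
        push_cast
        rfl
    _ ≤ 2 * B * ((n : ℝ) + 1) ^ 2 := by
        have : 0 ≤ B * (3 * n + 2) := by positivity
        linear_combination this

theorem hasConcentratingMoments (h : IsRegularMultiplier φ ψ) :
    HasConcentratingMoments fun n t => trigPoly (multiplierDerivCoeff φ n) t := by
  obtain ⟨C, E, hC, hE, hannulus⟩ := h.exists_integral_annulus_le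
  obtain ⟨B, hB, hbound⟩ := h.exists_norm_trigPoly_multiplierDerivCoeff_le
  refine ⟨fun n => by fun_prop, fun n t => ?_, ?_, fun δ hδ hδpi => ?_⟩
  · rw [AddCircle.coe_neg]
    refine norm_trigPoly_neg (fun k => ?_) _
    rw [h.multiplierDerivCoeff_apply, map_mul, Complex.conj_I, Complex.conj_ofReal, neg_mul]
  · refine ⟨π * (π * B) + C * (2 ^ E / (2 ^ E - 1)), fun n => ?_⟩
    have hN : (1 : ℝ) ≤ (n : ℝ) + 1 := by linarith [(n.cast_nonneg : (0 : ℝ) ≤ n)]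
    refine (integral_le_of_dyadic_le (S := π * B * ((n : ℝ) + 1)) (by fun_prop) hN (by positivity)
      hC hE (fun t ht => ?_) (hannulus n)).trans_eq ?_
    · calc t * ‖trigPoly (multiplierDerivCoeff φ n) t‖
          ≤ π / ((n : ℝ) + 1) * (B * ((n : ℝ) + 1) ^ 2) :=
            mul_le_mul ht.2 (hbound n t) (norm_nonneg _) (by positivity)
        _ = π * B * ((n : ℝ) + 1) := by field_simp
    · field_simp
  · exact tendsto_integral_of_dyadic_le (fun n => by fun_prop)
      (fun n t ht => mul_nonneg ht (norm_nonneg _)) hE hannulus hδ hδpi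

end IsRegularMultiplier

/-! ### Convergence at `d`-points -/

theorem intervalIntegrable_of_integrable_haarAddCircle {f : AddCircle (2 * π) → ℂ}
    (hf : Integrable f AddCircle.haarAddCircle) (a b : ℝ) :
    IntervalIntegrable (fun t : ℝ => f (t : AddCircle (2 * π))) volume a b := by
  have hvol : Integrable f volume := by
    rw [← memLp_one_iff_integrable] at hf ⊢
    exact memLp_haarAddCircle_iff.1 hf
  have hper : Function.Periodic (fun t : ℝ => f (t : AddCircle (2 * π))) (2 * π) := fun t => by
    simp
  refine hper.intervalIntegrable₀ two_pi_pos.ne' ?_ a b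
  rw [intervalIntegrable_iff_integrableOn_Ioc_of_le two_pi_pos.le]
  simpa [IntegrableOn, Function.comp_def] using
    (AddCircle.measurePreserving_mk (2 * π) 0).integrable_comp_of_integrable hvol

theorem IsDPointWith.hasDerivAt_integral_sub {f : AddCircle (2 * π) → ℂ}
    (hf : Integrable f AddCircle.haarAddCircle) {x : ℝ} {d : ℂ} (hd : IsDPointWith f x d) :
    HasDerivAt (fun y => ∫ t in (0 : ℝ)..y, (f ((x - t : ℝ) : AddCircle (2 * π)) - d)) 0 0 := by
  have hfi := intervalIntegrable_of_integrable_haarAddCircle hf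
  have hprimitive : (fun y => ∫ t in (0 : ℝ)..y, (f ((x - t : ℝ) : AddCircle (2 * π)) - d)) =
      fun y => ((∫ t in (0 : ℝ)..x, f (t : AddCircle (2 * π))) -
        ∫ t in (0 : ℝ)..(x - y), f (t : AddCircle (2 * π))) - y • d := by
    ext y
    rw [intervalIntegral.integral_sub (by simpa using (hfi (x - 0) (x - y)).comp_sub_left x)
        (by simp),
      intervalIntegral.integral_comp_sub_left (fun t : ℝ => f (t : AddCircle (2 * π))), sub_zero,
      intervalIntegral.integral_const, sub_zero,
      intervalIntegral.integral_interval_sub_left (hfi _ _) (hfi _ _)]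
  have hF : HasDerivAt (fun y : ℝ => ∫ t in (0 : ℝ)..(x - y), f (t : AddCircle (2 * π))) (-d) 0 :=
    HasDerivAt.comp_const_sub (f := fun y => ∫ t in (0 : ℝ)..y, f (t : AddCircle (2 * π))) x 0
      (by rwa [sub_zero])
  rw [hprimitive]
  exact ((hF.const_sub _).sub ((hasDerivAt_id (0 : ℝ)).smul_const d)).congr_deriv (by simp)

theorem IsRegularMultiplier.tendsto_multiplierMean {φ ψ : ℝ → ℝ} (h : IsRegularMultiplier φ ψ)
    {f : AddCircle (2 * π) → ℂ} (hf : Integrable f AddCircle.haarAddCircle) {x : ℝ} {d : ℂ}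
    (hd : IsDPointWith f x d) : Tendsto (fun n => multiplierMean φ f n x) atTop (𝓝 d) := by
  have hpi : (π : ℂ) ≠ 0 := by exact_mod_cast pi_ne_zero
  have hfi : ∀ a b, IntervalIntegrable (fun t : ℝ => f ((x - t : ℝ) : AddCircle (2 * π)))
      volume a b := fun a b => by
    simpa using (intervalIntegrable_of_integrable_haarAddCircle hf (x - a) (x - b)).comp_sub_left x
  have hperiodic : ((-π : ℝ) : AddCircle (2 * π)) = (π : ℝ) := by
    rw [← AddCircle.coe_add_period (2 * π) (-π)]
    ring_nf
  have hzero := h.hasConcentratingMoments.tendsto_integral_mul_kernel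
    (K := fun n t => trigPoly (multiplierCoeff φ n) t)
    (fun n t => hasDerivAt_trigPoly _ t) (fun n => by rw [hperiodic])
    (tendsto_integral_one_sub_cos_mul_multiplierCoeff h.eq_zero h.continuous.continuousAt)
    (fun a b => (hfi a b).sub intervalIntegrable_const) (hd.hasDerivAt_integral_sub hf)
  have hlim := (hzero.const_mul (2 * π : ℂ)⁻¹).add_const d
  rw [mul_zero, zero_add] at hlim
  refine hlim.congr fun n => ?_
  simp only [multiplierMean_eq_intervalIntegral h.eq_zero hf, sub_mul]
  rw [intervalIntegral.integral_sub ((hfi _ _).mul_continuousOn (by fun_prop))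
      (Continuous.intervalIntegrable (by fun_prop) _ _),
    intervalIntegral.integral_const_mul, intervalIntegral_multiplierCoeff h.eq_zero h.map_zero]
  field_simp
  ring

/-! ### Regularity of the Riesz functions -/

theorem holderOnWith_rpow_of_le_one {p : ℝ≥0} (hp : p ≤ 1) :
    HolderOnWith 1 p (fun x : ℝ => x ^ (p : ℝ)) (Set.Ici 0) := by
  intro x hx y hy
  wlog hyx : y ≤ x generalizing x y
  · rw [edist_comm, edist_comm x]
    exact this y hy x hx (le_of_not_ge hyx)
  have hsub : x ^ (p : ℝ) ≤ y ^ (p : ℝ) + (x - y) ^ (p : ℝ) := by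
    simpa using Real.rpow_add_le_add_rpow hy (sub_nonneg.2 hyx) p.coe_nonneg hp
  have hmono : y ^ (p : ℝ) ≤ x ^ (p : ℝ) := Real.rpow_le_rpow hy hyx p.2
  rw [ENNReal.coe_one, one_mul, edist_dist, edist_dist,
    ENNReal.ofReal_rpow_of_nonneg dist_nonneg p.coe_nonneg, Real.dist_eq, Real.dist_eq,
    abs_of_nonneg (sub_nonneg.2 hyx), abs_of_nonneg (sub_nonneg.2 hmono)]
  exact ENNReal.ofReal_le_ofReal (by linarith)

theorem lipschitzOnWith_rpow_of_one_le {p : ℝ≥0} (hp : 1 ≤ p) :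
    LipschitzOnWith p (fun x : ℝ => x ^ (p : ℝ)) (Set.Icc 0 1) := by
  have hp' : (1 : ℝ) ≤ p := NNReal.one_le_coe.2 hp
  refine (convex_Icc 0 1).lipschitzOnWith_of_nnnorm_hasDerivWithin_le
    (fun x _ => (Real.hasDerivAt_rpow_const (.inr hp')).hasDerivWithinAt) fun x hx => ?_
  have hle : x ^ ((p : ℝ) - 1) ≤ 1 := Real.rpow_le_one hx.1 hx.2 (sub_nonneg.2 hp')
  rw [← NNReal.coe_le_coe, coe_nnnorm,
    Real.norm_of_nonneg (mul_nonneg p.coe_nonneg (Real.rpow_nonneg hx.1 _))]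
  exact mul_le_of_le_one_right p.coe_nonneg hle

theorem holderOnWith_rpow (p : ℝ≥0) :
    HolderOnWith (max p 1) (min p 1) (fun x : ℝ => x ^ (p : ℝ)) (Set.Icc 0 1) := by
  rcases le_total p 1 with hp | hp
  · rw [max_eq_right hp, min_eq_left hp]
    exact (holderOnWith_rpow_of_le_one hp).mono Set.Icc_subset_Ici_self
  · rw [max_eq_left hp, min_eq_right hp, holderOnWith_one]
    exact lipschitzOnWith_rpow_of_one_le hp

theorem rieszFun_nonneg (α γ x : ℝ) : 0 ≤ rieszFun α γ x :=
  Real.rpow_nonneg (le_max_right _ _) _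

theorem rieszFun_le_one {α γ : ℝ} (hγ : 0 ≤ γ) (x : ℝ) : rieszFun α γ x ≤ 1 := by
  refine Real.rpow_le_one (le_max_right _ _) (max_le ?_ zero_le_one) hγ
  linarith [Real.rpow_nonneg (abs_nonneg x) α]

theorem rieszFun_zero {α : ℝ} (hα : α ≠ 0) (γ : ℝ) : rieszFun α γ 0 = 1 := by
  simp [rieszFun, hα]

theorem rieszFun_le_of_abs_le {α γ : ℝ} (hα : 0 ≤ α) (hγ : 0 ≤ γ) {x y : ℝ} (h : |x| ≤ |y|) :
    rieszFun α γ y ≤ rieszFun α γ x := by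
  unfold rieszFun
  gcongr

theorem continuous_rieszFun {α γ : ℝ} (hα : 0 ≤ α) (hγ : 0 ≤ γ) : Continuous (rieszFun α γ) :=
  ((continuous_const.sub (continuous_abs.rpow_const fun _ => .inr hα)).max
    continuous_const).rpow_const fun _ => .inr hγ

theorem max_one_sub_rpow {α : ℝ} (hα : 0 ≤ α) (x : ℝ) :
    max (1 - |x| ^ α) 0 = 1 - min |x| 1 ^ α := by
  rcases le_total |x| 1 with h | h
  · rw [min_eq_left h, max_eq_left (sub_nonneg.2 (Real.rpow_le_one (abs_nonneg x) h hα))]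
  · rw [min_eq_right h, Real.one_rpow, sub_self,
      max_eq_right (sub_nonpos.2 (Real.one_le_rpow h hα))]

theorem holderWith_rieszFun (α γ : ℝ≥0) :
    HolderWith (max γ 1 * max α 1 ^ ((min γ 1 : ℝ≥0) : ℝ)) (min γ 1 * min α 1) (rieszFun α γ) := by
  have hmem : ∀ x : ℝ, min |x| 1 ∈ Set.Icc (0 : ℝ) 1 := fun x =>
    ⟨le_min (abs_nonneg _) zero_le_one, min_le_right _ _⟩
  have htrunc : HolderWith 1 1 (fun x : ℝ => min |x| 1) := by
    rw [holderWith_one]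
    simpa using (lipschitzWith_one_norm (E := ℝ)).min_const 1
  have hbase : HolderWith (max α 1) (min α 1) (fun x : ℝ => 1 - min |x| 1 ^ (α : ℝ)) := by
    have h := (holderOnWith_rpow α).comp_holderWith htrunc hmem
    intro x y
    simpa using h x y
  have h := (holderOnWith_rpow γ).comp_holderWith hbase fun x =>
    ⟨sub_nonneg.2 (Real.rpow_le_one (hmem x).1 (hmem x).2 α.coe_nonneg),
      sub_le_self _ (Real.rpow_nonneg (hmem x).1 _)⟩
  convert! h using 1
  ext x
  simp only [rieszFun, Function.comp_apply, max_one_sub_rpow α.coe_nonneg]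

theorem holderWith_zero_rieszFun (α : ℝ) {γ : ℝ} (hγ : 0 ≤ γ) : HolderWith 1 0 (rieszFun α γ) := by
  intro x y
  have h : dist (rieszFun α γ x) (rieszFun α γ y) ≤ 1 := by
    rw [Real.dist_eq, abs_sub_le_iff]
    constructor <;> linarith [rieszFun_nonneg α γ x, rieszFun_nonneg α γ y,
      rieszFun_le_one (α := α) hγ x, rieszFun_le_one (α := α) hγ y]
  simpa [edist_dist] using h

theorem integral_Ioi_comp_add_right (v : ℝ → ℝ) (a c : ℝ) :
    ∫ x in Set.Ioi a, v (x + c) = ∫ x in Set.Ioi (a + c), v x := by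
  simpa using (measurePreserving_add_right volume c).setIntegral_preimage_emb
    (measurableEmbedding_addRight c) v (Set.Ioi (a + c))

/-- The integrand is even about `s / 2`, and on the half-line beyond `s / 2` the difference has a
sign, so that the integral telescopes. -/
theorem integral_abs_sub_comp_sub_right_le {v : ℝ → ℝ} (hv : Integrable v) (h1 : ∀ x, v x ≤ 1)
    (hmono : ∀ x y, |x| ≤ |y| → v y ≤ v x) {s : ℝ} (hs : 0 ≤ s) :
    ∫ x, |v x - v (x - s)| ≤ 2 * s := by
  have heven : ∀ x, v (-x) = v x := fun x =>
    le_antisymm (hmono _ _ (by simp)) (hmono _ _ (by simp))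
  set g : ℝ → ℝ := fun x => |v (x + s / 2) - v (x + -(s / 2))| with hg
  have hg_abs : ∀ x, g |x| = g x := fun x => by
    rcases abs_choice x with h | h <;> rw [h]
    simp only [hg]
    rw [← heven (x + s / 2), ← heven (x + -(s / 2)), abs_sub_comm]
    ring_nf
  have hg_pos : ∀ x ∈ Set.Ioi (0 : ℝ), g x = v (x + -(s / 2)) - v (x + s / 2) := fun x hx => by
    have hle : |x + -(s / 2)| ≤ |x + s / 2| := by
      rw [Set.mem_Ioi] at hx
      rw [abs_of_nonneg (a := x + s / 2) (by linarith), abs_le]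
      constructor <;> linarith
    simp only [hg]
    rw [abs_of_nonpos (sub_nonpos.2 (hmono _ _ hle)), neg_sub]
  calc ∫ x, |v x - v (x - s)| = ∫ x, g x := by
        rw [← integral_add_right_eq_self _ (s / 2)]
        refine integral_congr_ae (.of_forall fun x => ?_)
        simp only [hg]
        ring_nf
    _ = 2 * ∫ x in Set.Ioi 0, g x := by
        rw [← integral_comp_abs]
        simp only [hg_abs]
    _ = 2 * ∫ x in (-(s / 2))..(s / 2), v x := by
        rw [setIntegral_congr_fun measurableSet_Ioi hg_pos,
          integral_sub (hv.comp_add_right _).integrableOn (hv.comp_add_right _).integrableOn,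
          integral_Ioi_comp_add_right, integral_Ioi_comp_add_right, zero_add, zero_add,
          intervalIntegral.integral_Ioi_sub_Ioi hv.integrableOn (by linarith)]
    _ ≤ 2 * s := by
        have h := intervalIntegral.integral_mono_on (a := -(s / 2)) (b := s / 2) (by linarith)
          hv.intervalIntegrable (intervalIntegrable_const (μ := volume)) fun x _ => h1 x
        rw [intervalIntegral.integral_const, smul_eq_mul, mul_one] at h
        linarith

theorem integrable_rieszFun {α γ : ℝ} (hα : 0 < α) (hγ : 0 < γ) : Integrable (rieszFun α γ) := by
  refine (continuous_rieszFun hα.le hγ.le).integrable_of_hasCompactSupport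
    (.of_support_subset_isCompact (isCompact_Icc (a := (-1 : ℝ)) (b := 1)) fun x hx => ?_)
  rw [Set.mem_Icc, ← abs_le]
  by_contra hcon
  exact hx (rieszFun_eq_zero hα hγ (not_le.1 hcon).le)

/-- The derivative of `x ↦ x (1 - |x|^α)_+^β`. -/
def rieszDeriv (α β x : ℝ) : ℝ :=
  (1 + α * β) * rieszFun α β x - α * β * rieszFun α (β - 1) x

theorem hasDerivAt_mul_rieszFun_of_abs_lt_one {α : ℝ} (hα : 0 < α) (β : ℝ) {x : ℝ} (hx0 : x ≠ 0)
    (hx1 : |x| < 1) : HasDerivAt (fun x => x * rieszFun α β x) (rieszDeriv α β x) x := by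
  have hpos : ∀ y : ℝ, |y| < 1 → 0 < 1 - |y| ^ α := fun y hy =>
    sub_pos.2 (Real.rpow_lt_one (abs_nonneg y) hy hα)
  have hax : 0 < |x| := abs_pos.2 hx0
  have heq : (fun y => y * rieszFun α β y) =ᶠ[𝓝 x] fun y => y * (1 - |y| ^ α) ^ β := by
    filter_upwards [continuous_abs.continuousAt.eventually (gt_mem_nhds hx1)] with y hy
    rw [rieszFun, max_eq_left (hpos y hy).le]
  have hderiv := (hasDerivAt_id x).mul
    ((((hasDerivAt_abs hx0).rpow_const (p := α) (.inl hax.ne')).const_sub 1).rpow_const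
      (p := β) (.inl (hpos x hx1).ne'))
  refine (hderiv.congr_of_eventuallyEq heq).congr_deriv ?_
  have habs : x * (SignType.sign x : ℝ) = |x| := self_mul_sign x
  have hpow : |x| * |x| ^ (α - 1) = |x| ^ α := by
    rw [Real.rpow_sub_one hax.ne', mul_div_cancel₀ _ hax.ne']
  have hpow' : (1 - |x| ^ α) ^ β = (1 - |x| ^ α) * (1 - |x| ^ α) ^ (β - 1) := by
    rw [Real.rpow_sub_one (hpos x hx1).ne', mul_div_cancel₀ _ (hpos x hx1).ne']
  rw [rieszDeriv, rieszFun, rieszFun, max_eq_left (hpos x hx1).le, hpow']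
  simp only [id, one_mul]
  rw [← hpow, ← habs]
  ring

theorem hasDerivAt_mul_rieszFun_of_one_lt_abs {α β : ℝ} (hα : 0 < α) (hβ : 1 < β) {x : ℝ}
    (hx : 1 < |x|) : HasDerivAt (fun x => x * rieszFun α β x) (rieszDeriv α β x) x := by
  have hβ0 : 0 < β := one_pos.trans hβ
  have heq : (fun y => y * rieszFun α β y) =ᶠ[𝓝 x] fun _ => 0 := by
    filter_upwards [continuous_abs.continuousAt.eventually (lt_mem_nhds hx)] with y hy
    rw [rieszFun_eq_zero hα hβ0 hy.le, mul_zero]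
  refine ((hasDerivAt_const x (0 : ℝ)).congr_of_eventuallyEq heq).congr_deriv ?_
  rw [rieszDeriv, rieszFun_eq_zero hα hβ0 hx.le, rieszFun_eq_zero hα (sub_pos.2 hβ) hx.le,
    mul_zero, mul_zero, sub_zero]

theorem exists_holderWith_rieszDeriv {α β : ℝ} (hα : 0 < α) (hβ : 1 < β) :
    ∃ C r : ℝ≥0, 0 < r ∧ HolderWith C r (rieszDeriv α β) := by
  lift α to ℝ≥0 using hα.le
  obtain ⟨γ, rfl⟩ : ∃ γ : ℝ≥0, β = γ + 1 :=
    ⟨(β - 1).toNNReal, by rw [Real.coe_toNNReal _ (sub_nonneg.2 hβ.le), sub_add_cancel]⟩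
  have hγ : 0 < γ := by simpa using hβ
  have hα' : 0 < α := by simpa using hα
  have hfun := (holderWith_zero_rieszFun α (γ + 1).coe_nonneg).of_le_of_le
    (holderWith_rieszFun α (γ + 1)) (t := min γ 1 * min α 1) (zero_le)
    (by gcongr; exact le_self_add)
  have hcomb := (hfun.smul (1 + (α : ℝ) * (γ + 1))).add
    ((holderWith_rieszFun α γ).smul (-((α : ℝ) * (γ + 1))))
  have heq : rieszDeriv α (γ + 1) = (1 + (α : ℝ) * (γ + 1)) • rieszFun α (γ + 1 : ℝ≥0) +
      -((α : ℝ) * (γ + 1)) • rieszFun α γ := by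
    ext x
    simp only [rieszDeriv, Pi.add_apply, Pi.smul_apply, smul_eq_mul, NNReal.coe_add,
      NNReal.coe_one, add_sub_cancel_right]
    ring
  exact ⟨_, min γ 1 * min α 1, by positivity, heq ▸ hcomb⟩

theorem mul_rieszFun_sub_mul_rieszFun {α β : ℝ} (hα : 0 < α) (hβ : 1 < β) (a b : ℝ) :
    b * rieszFun α β b - a * rieszFun α β a = ∫ x in a..b, rieszDeriv α β x := by
  have hcont := continuous_rieszFun hα.le (one_pos.trans hβ).le
  obtain ⟨C, r, hr, hderiv⟩ := exists_holderWith_rieszDeriv hα hβ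
  refine (integral_eq_of_hasDerivAt_off_countable (fun x => x * rieszFun α β x) _
    (s := {0, 1, -1}) (Set.toFinite _).countable (by fun_prop) ?_
    ((hderiv.continuous hr).intervalIntegrable _ _)).symm
  rintro x ⟨_, hx⟩
  simp only [Set.mem_insert_iff, Set.mem_singleton_iff, not_or] at hx
  have hx1 : |x| ≠ 1 := fun h => ((abs_eq zero_le_one).1 h).elim hx.2.1 hx.2.2
  rcases lt_or_gt_of_ne hx1 with h | h
  · exact hasDerivAt_mul_rieszFun_of_abs_lt_one hα β hx.1 h
  · exact hasDerivAt_mul_rieszFun_of_one_lt_abs hα hβ h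

theorem integral_abs_rieszFun_sub_le {α γ : ℝ} (hα : 0 < α) (hγ : 0 < γ) {s : ℝ} (hs : 0 ≤ s) :
    ∫ x, |rieszFun α γ x - rieszFun α γ (x - s)| ≤ 2 * s :=
  integral_abs_sub_comp_sub_right_le (integrable_rieszFun hα hγ) (rieszFun_le_one hγ.le)
    (fun _ _ => rieszFun_le_of_abs_le hα.le hγ.le) hs

theorem integral_abs_rieszDeriv_sub_le {α β : ℝ} (hα : 0 < α) (hβ : 1 < β) {s : ℝ} (hs : 0 ≤ s) :
    ∫ x, |rieszDeriv α β x - rieszDeriv α β (x - s)| ≤ (1 + 2 * α * β) * 2 * s := by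
  have hβ0 : 0 < β := one_pos.trans hβ
  have hi : ∀ γ, 0 < γ → Integrable fun x => |rieszFun α γ x - rieszFun α γ (x - s)| := fun γ hγ =>
    ((integrable_rieszFun hα hγ).sub ((integrable_rieszFun hα hγ).comp_sub_right s)).abs
  have hi₁ := (hi β hβ0).const_mul (1 + α * β)
  have hi₂ := (hi (β - 1) (sub_pos.2 hβ)).const_mul (α * β)
  calc ∫ x, |rieszDeriv α β x - rieszDeriv α β (x - s)|
      ≤ ∫ x, ((1 + α * β) * |rieszFun α β x - rieszFun α β (x - s)| +
          α * β * |rieszFun α (β - 1) x - rieszFun α (β - 1) (x - s)|) := by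
        refine integral_mono_of_nonneg (.of_forall fun x => abs_nonneg _) (hi₁.add hi₂)
          (.of_forall fun x => ?_)
        have hsplit : rieszDeriv α β x - rieszDeriv α β (x - s) =
            (1 + α * β) * (rieszFun α β x - rieszFun α β (x - s)) -
              α * β * (rieszFun α (β - 1) x - rieszFun α (β - 1) (x - s)) := by
          unfold rieszDeriv
          ring
        simp only [hsplit]
        refine (abs_sub _ _).trans_eq ?_
        rw [abs_mul, abs_mul, abs_of_nonneg (by positivity : 0 ≤ α * β),
          abs_of_nonneg (by positivity : 0 ≤ 1 + α * β)]
    _ ≤ (1 + α * β) * (2 * s) + α * β * (2 * s) := by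
        rw [integral_add hi₁ hi₂, integral_const_mul, integral_const_mul]
        gcongr
        · exact integral_abs_rieszFun_sub_le hα hβ0 hs
        · exact integral_abs_rieszFun_sub_le hα (sub_pos.2 hβ) hs
    _ = (1 + 2 * α * β) * 2 * s := by ring

theorem isRegularMultiplier_rieszFun {α β : ℝ} (hα : 0 < α) (hβ : 1 < β) :
    IsRegularMultiplier (rieszFun α β) (rieszDeriv α β) where
  map_zero := rieszFun_zero hα.ne' β
  eq_zero _ := rieszFun_eq_zero hα (one_pos.trans hβ)
  continuous := continuous_rieszFun hα.le (one_pos.trans hβ).le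
  mul_sub_mul_eq_integral := mul_rieszFun_sub_mul_rieszFun hα hβ
  exists_holderWith := exists_holderWith_rieszDeriv hα hβ
  integrable := ((integrable_rieszFun hα (one_pos.trans hβ)).const_mul _).sub
    ((integrable_rieszFun hα (sub_pos.2 hβ)).const_mul _)
  exists_integral_abs_sub_le := ⟨_, fun _ => integral_abs_rieszDeriv_sub_le hα hβ⟩

/-! ### Sine sums -/

theorem norm_sum_range_smul_le_of_antitone {E : Type*} [NormedAddCommGroup E] [NormedSpace ℝ E]
    {c : ℕ → ℝ} {z : ℕ → E} {B : ℝ} (hc : Antitone c) (hc0 : ∀ i, 0 ≤ c i)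
    (hz : ∀ m, ‖∑ i ∈ Finset.range m, z i‖ ≤ B) (m : ℕ) :
    ‖∑ i ∈ Finset.range m, c i • z i‖ ≤ c 0 * B := by
  have habel : ‖(∑ i ∈ Finset.range m, c i • z i) - c m • ∑ i ∈ Finset.range m, z i‖ ≤
      (c 0 - c m) * B := by
    induction m with
    | zero => simp
    | succ m ih =>
      have hsucc : (∑ i ∈ Finset.range (m + 1), c i • z i) -
          c (m + 1) • ∑ i ∈ Finset.range (m + 1), z i =
          ((∑ i ∈ Finset.range m, c i • z i) - c m • ∑ i ∈ Finset.range m, z i) +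
            (c m - c (m + 1)) • ∑ i ∈ Finset.range (m + 1), z i := by
        simp only [Finset.sum_range_succ, smul_add, sub_smul]
        abel
      have hdiff : 0 ≤ c m - c (m + 1) := sub_nonneg.2 (hc m.le_succ)
      calc _ ≤ (c 0 - c m) * B + (c m - c (m + 1)) * B := by
            rw [hsucc]
            refine norm_add_le_of_le ih ?_
            rw [norm_smul, Real.norm_of_nonneg hdiff]
            exact mul_le_mul_of_nonneg_left (hz _) hdiff
        _ = (c 0 - c (m + 1)) * B := by ring
  have hlast : ‖c m • ∑ i ∈ Finset.range m, z i‖ ≤ c m * B := by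
    rw [norm_smul, Real.norm_of_nonneg (hc0 m)]
    exact mul_le_mul_of_nonneg_left (hz m) (hc0 m)
  calc _ ≤ (c 0 - c m) * B + c m * B := by
        rw [← sub_add_cancel (∑ i ∈ Finset.range m, c i • z i) (c m • ∑ i ∈ Finset.range m, z i)]
        exact norm_add_le_of_le habel hlast
    _ = c 0 * B := by ring

theorem two_mul_sin_half_mul_sum_sin (t : ℝ) (a m : ℕ) :
    2 * sin (t / 2) * ∑ i ∈ Finset.range m, sin (((a + i : ℕ) : ℝ) * t) =
      cos ((a : ℝ) * t - t / 2) - cos (((a + m : ℕ) : ℝ) * t - t / 2) := by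
  induction m with
  | zero => simp
  | succ m ih =>
    have hshift : ((a + (m + 1) : ℕ) : ℝ) * t - t / 2 = ((a + m : ℕ) : ℝ) * t + t / 2 := by
      push_cast
      ring
    rw [Finset.sum_range_succ, mul_add, ih, hshift, cos_add, cos_sub (((a + m : ℕ) : ℝ) * t)]
    ring

theorem abs_sum_sin_le {t : ℝ} (ht : 0 < t) (htpi : t ≤ π) (a m : ℕ) :
    |∑ i ∈ Finset.range m, sin (((a + i : ℕ) : ℝ) * t)| ≤ π / t := by
  have hjordan : t / π ≤ sin (t / 2) :=
    calc t / π = 2 / π * (t / 2) := by ring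
      _ ≤ _ := mul_le_sin (by linarith) (by linarith)
  have hsin : 0 < sin (t / 2) := (div_pos ht pi_pos).trans_le hjordan
  have hcos : |2 * sin (t / 2) * ∑ i ∈ Finset.range m, sin (((a + i : ℕ) : ℝ) * t)| ≤ 2 := by
    rw [two_mul_sin_half_mul_sum_sin]
    exact (abs_sub _ _).trans
      ((add_le_add (abs_cos_le_one _) (abs_cos_le_one _)).trans_eq one_add_one_eq_two)
  rw [abs_mul, abs_of_pos (mul_pos two_pos hsin), ← le_div_iff₀' (mul_pos two_pos hsin)] at hcos
  calc _ ≤ 2 / (2 * sin (t / 2)) := hcos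
    _ ≤ 2 / (2 * (t / π)) := by gcongr
    _ = π / t := by field_simp

theorem abs_sum_Ico_sin_div_le_of_sub_mul_le_one {t : ℝ} (ht : 0 ≤ t) {a b : ℕ}
    (hab : ((b - a : ℕ) : ℝ) * t ≤ 1) : |∑ j ∈ Finset.Ico a b, sin (j * t) / j| ≤ 1 := by
  have hterm : ∀ j : ℕ, |sin (j * t) / j| ≤ t := fun j => by
    rw [abs_div, Nat.abs_cast]
    refine div_le_of_le_mul₀ j.cast_nonneg ht (abs_sin_le_abs.trans_eq ?_)
    rw [abs_of_nonneg (by positivity), mul_comm]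
  calc |∑ j ∈ Finset.Ico a b, sin (j * t) / j| ≤ ∑ _j ∈ Finset.Ico a b, t :=
        Finset.abs_sum_le_sum_abs _ _ |>.trans (Finset.sum_le_sum fun j _ => hterm j)
    _ ≤ 1 := by rwa [Finset.sum_const, Nat.card_Ico, nsmul_eq_mul]

theorem abs_sum_Ico_sin_div_le_of_one_le_mul {t : ℝ} (ht : 0 < t) (htpi : t ≤ π) {a : ℕ}
    (ha : 1 ≤ a * t) (b : ℕ) : |∑ j ∈ Finset.Ico a b, sin (j * t) / j| ≤ π := by
  have ha0 : (0 : ℝ) < a := pos_of_mul_pos_left (zero_lt_one.trans_le ha) ht.le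
  have hanti : Antitone fun i : ℕ => ((a + i : ℕ) : ℝ)⁻¹ := fun i j hij => by
    have : (0 : ℝ) < ((a + i : ℕ) : ℝ) := by push_cast; positivity
    exact inv_anti₀ this (by exact_mod_cast Nat.add_le_add_left hij a)
  have habel := norm_sum_range_smul_le_of_antitone (z := fun i => sin (((a + i : ℕ) : ℝ) * t))
    hanti (fun i => by positivity) (abs_sum_sin_le ht htpi a) (b - a)
  simp only [Finset.sum_Ico_eq_sum_range, div_eq_inv_mul]
  calc _ ≤ (a : ℝ)⁻¹ * (π / t) := habel
    _ = π / (a * t) := by field_simp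
    _ ≤ π := div_le_self pi_pos.le ha

theorem abs_sum_Ico_sin_div_le {t : ℝ} (ht : |t| ≤ π) {L : ℕ} (hL : 1 ≤ L) (K : ℕ) :
    |∑ j ∈ Finset.Ico L K, sin (j * t) / j| ≤ 1 + π := by
  have hpi := pi_pos
  wlog htpos : 0 < t generalizing t
  · rcases (not_lt.1 htpos).eq_or_lt with rfl | hneg
    · simpa using by linarith
    · have := this (t := -t) (by rwa [abs_neg]) (by linarith)
      simpa only [mul_neg, sin_neg, neg_div, Finset.sum_neg_distrib, abs_neg] using this
  rw [abs_of_pos htpos] at ht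
  set p := ⌈1 / t⌉₊
  have hp : p < 1 / t + 1 := Nat.ceil_lt_add_one (by positivity)
  have hhead : ∀ b ≤ p, |∑ j ∈ Finset.Ico L b, sin (j * t) / j| ≤ 1 := fun b hb => by
    refine abs_sum_Ico_sin_div_le_of_sub_mul_le_one htpos.le ?_
    rw [← le_div_iff₀ htpos]
    rcases le_total b L with hbL | hLb
    · simpa [Nat.sub_eq_zero_of_le hbL] using htpos.le
    · have : ((b - L : ℕ) : ℝ) + 1 ≤ p := by exact_mod_cast (by omega : b - L + 1 ≤ p)
      linarith
  have htail : ∀ a, p ≤ a → |∑ j ∈ Finset.Ico a K, sin (j * t) / j| ≤ π := fun a ha =>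
    abs_sum_Ico_sin_div_le_of_one_le_mul htpos ht
      ((div_le_iff₀ htpos).1 ((Nat.le_ceil _).trans (Nat.cast_le.2 ha))) K
  rcases le_total p L with hpL | hLp
  · linarith [htail L hpL]
  rcases le_total K p with hKp | hpK
  · linarith [hhead K hKp]
  · rw [← Finset.sum_Ico_consecutive _ hLp hpK]
    exact (abs_add_le _ _).trans (add_le_add (hhead p le_rfl) (htail p le_rfl))

theorem sum_Ico_inv_sq_le {L : ℕ} (hL : 1 ≤ L) (K : ℕ) :
    ∑ j ∈ Finset.Ico L K, ((j : ℝ) ^ 2)⁻¹ ≤ 2 / L := by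
  have hIoo : Finset.Ico L K = Finset.Ioo (L - 1) K := by
    ext j
    simp only [Finset.mem_Ioo, Finset.mem_Ico]
    omega
  rw [hIoo]
  refine (sum_Ioo_inv_sq_le (α := ℝ) (L - 1) K).trans_eq ?_
  rw [← Nat.cast_add_one, Nat.sub_add_cancel hL]

theorem log_div_le_sum_Ico_inv {L K : ℕ} (hL : 1 ≤ L) (hLK : L ≤ K) :
    log (K / L) ≤ ∑ j ∈ Finset.Ico L K, (j : ℝ)⁻¹ := by
  have hL0 : (0 : ℝ) < L := by exact_mod_cast hL
  have hK0 : (0 : ℝ) < K := by exact_mod_cast hL.trans hLK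
  rw [← integral_inv_of_pos hL0 hK0]
  exact AntitoneOn.integral_le_sum_Ico hLK fun x hx y _ hxy => inv_anti₀ (hL0.trans_le hx.1) hxy

/-! ### Humps -/

theorem trigPoly_smul_eq_linearCombination (m : ℤ → ℂ) (b : ℤ →₀ ℂ) (x : AddCircle (2 * π)) :
    trigPoly (m • b) x = Finsupp.linearCombination ℂ (fun k => m k * fourier k x) b := by
  rw [trigPoly_smul_apply, Finsupp.linearCombination_apply, Finsupp.sum]
  exact Finset.sum_congr rfl fun k _ => by rw [smul_eq_mul]; ring

theorem multiplierMean_trigPoly (φ : ℝ → ℝ) (b : ℤ →₀ ℂ) (n : ℕ) (x : ℝ) :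
    multiplierMean φ (trigPoly b) n x =
      trigPoly ((fun k : ℤ => (φ (k / (n + 1)) : ℂ)) • b) x := by
  rw [trigPoly_smul_apply]
  simp only [multiplierMean, fourierCoeff_trigPoly, fourier_coe_two_pi]
  refine tsum_eq_sum fun k hk => ?_
  rw [Finsupp.notMem_support_iff.1 hk, mul_zero, zero_mul]

theorem integral_norm_trigPoly_sum_single_le {ι : Type*} (s : Finset ι) {e : ι → ℤ}
    (he : Set.InjOn e s) (c : ι → ℂ) :
    ∫ x, ‖trigPoly (∑ i ∈ s, Finsupp.single (e i) (c i)) x‖ ∂AddCircle.haarAddCircle ≤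
      √(∑ i ∈ s, ‖c i‖ ^ 2) := by
  classical
  set b := ∑ i ∈ s, Finsupp.single (e i) (c i) with hb
  have hcoeff : ∀ i ∈ s, b (e i) = c i := fun i hi => by
    rw [hb, Finsupp.finsetSum_apply, Finset.sum_eq_single_of_mem i hi, Finsupp.single_eq_same]
    exact fun j hj hji => Finsupp.single_eq_of_ne' fun h => hji (he hj hi h)
  have hzero : ∀ k ∉ s.image e, b k = 0 := fun k hk => by
    rw [hb, Finsupp.finsetSum_apply]
    exact Finset.sum_eq_zero fun i hi =>
      Finsupp.single_eq_of_ne' fun h => hk (h ▸ Finset.mem_image_of_mem e hi)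
  have hparseval : ∫ x, ‖trigPoly b x‖ ^ 2 ∂AddCircle.haarAddCircle = ∑ i ∈ s, ‖c i‖ ^ 2 := by
    rw [integral_haarAddCircle_eq_intervalIntegral _ (-π), show -π + 2 * π = π by ring,
      integral_norm_sq_trigPoly, smul_eq_mul, inv_mul_cancel_left₀ two_pi_pos.ne',
      tsum_eq_sum (s := s.image e) fun k hk => by rw [hzero k hk, norm_zero]; norm_num,
      Finset.sum_image he]
    exact Finset.sum_congr rfl fun i hi => by rw [hcoeff i hi]
  rw [← hparseval]
  have hcont : Continuous fun x => ‖trigPoly b x‖ := by fun_prop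
  exact le_sqrt_of_sq_le ((convexOn_pow 2).map_integral_le (continuous_pow 2).continuousOn
    isClosed_Ici
    (.of_forall fun _ => norm_nonneg _)
    (hcont.integrable_of_hasCompactSupport (.of_compactSpace _))
    ((hcont.pow 2).integrable_of_hasCompactSupport (.of_compactSpace _)))

theorem integrable_norm_trigPoly (b : ℤ →₀ ℂ) :
    Integrable (fun x => ‖trigPoly b x‖) AddCircle.haarAddCircle :=
  Continuous.integrable_of_hasCompactSupport (by fun_prop) (.of_compactSpace _)

theorem integral_norm_trigPoly_add_le (b c : ℤ →₀ ℂ) :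
    ∫ x, ‖trigPoly (b + c) x‖ ∂AddCircle.haarAddCircle ≤
      ∫ x, ‖trigPoly b x‖ ∂AddCircle.haarAddCircle +
        ∫ x, ‖trigPoly c x‖ ∂AddCircle.haarAddCircle := by
  rw [← integral_add (integrable_norm_trigPoly b) (integrable_norm_trigPoly c)]
  refine integral_mono (integrable_norm_trigPoly _)
    ((integrable_norm_trigPoly b).add (integrable_norm_trigPoly c)) fun x => ?_
  rw [map_add]
  exact norm_add_le _ _

theorem integral_norm_trigPoly_sub_le (b c : ℤ →₀ ℂ) :
    ∫ x, ‖trigPoly (b - c) x‖ ∂AddCircle.haarAddCircle ≤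
      ∫ x, ‖trigPoly b x‖ ∂AddCircle.haarAddCircle +
        ∫ x, ‖trigPoly c x‖ ∂AddCircle.haarAddCircle := by
  simpa [sub_eq_add_neg] using integral_norm_trigPoly_add_le b (-c)

/-- The value at `0` of `∑_{L ≤ |k| < K} k⁻² e^{ikt}`. -/
def humpMass (L K : ℕ) : ℝ :=
  ∑ j ∈ Finset.Ico L K, 2 * ((j : ℝ) ^ 2)⁻¹

/-- The coefficients of the hump
`∑_{L ≤ |k| < K} k⁻² e^{ikt} - (humpMass L K / L) ∑_{0 ≤ k < L} e^{ikt}`, a trigonometric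
polynomial that vanishes at `0`, is Lipschitz uniformly in `L` and `K`, and whose negative
frequencies carry a large one-sided derivative. -/
def humpCoeff (L K : ℕ) : ℤ →₀ ℂ :=
  ∑ j ∈ Finset.Ico L K, Finsupp.single (j : ℤ) ((j : ℂ) ^ 2)⁻¹ +
    ∑ j ∈ Finset.Ico L K, Finsupp.single (-(j : ℤ)) ((j : ℂ) ^ 2)⁻¹ -
    ∑ j ∈ Finset.range L, Finsupp.single (j : ℤ) (humpMass L K / L : ℂ)

theorem humpMass_nonneg (L K : ℕ) : 0 ≤ humpMass L K :=
  Finset.sum_nonneg fun _ _ => by positivity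

theorem humpMass_le {L : ℕ} (hL : 1 ≤ L) (K : ℕ) : humpMass L K ≤ 4 / L := by
  rw [humpMass, ← Finset.mul_sum]
  calc _ ≤ 2 * (2 / (L : ℝ)) := by gcongr; exact sum_Ico_inv_sq_le hL K
    _ = 4 / L := by ring

theorem norm_humpMass_div_le {L : ℕ} (hL : 1 ≤ L) (K : ℕ) :
    ‖(humpMass L K / L : ℂ)‖ ≤ 4 / (L : ℝ) ^ 2 := by
  rw [norm_div, Complex.norm_real, Complex.norm_natCast, Real.norm_of_nonneg (humpMass_nonneg L K),
    sq, ← div_div]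
  gcongr
  exact humpMass_le hL K

theorem linearCombination_humpCoeff {E : Type*} [AddCommGroup E] [Module ℂ E] (L K : ℕ)
    (v : ℤ → E) :
    Finsupp.linearCombination ℂ v (humpCoeff L K) =
      ∑ j ∈ Finset.Ico L K, ((j : ℂ) ^ 2)⁻¹ • (v j + v (-j)) -
        (humpMass L K / L : ℂ) • ∑ j ∈ Finset.range L, v j := by
  simp only [humpCoeff, map_sub, map_add, map_sum, Finsupp.linearCombination_single, smul_add,
    Finset.sum_add_distrib, Finset.smul_sum]

theorem trigPoly_humpCoeff_zero {L : ℕ} (hL : 1 ≤ L) (K : ℕ) : trigPoly (humpCoeff L K) 0 = 0 := by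
  have hL0 : (L : ℂ) ≠ 0 := by exact_mod_cast (by omega : L ≠ 0)
  have hmass : (humpMass L K : ℂ) = ∑ j ∈ Finset.Ico L K, ((j : ℂ) ^ 2)⁻¹ * (1 + 1) := by
    rw [humpMass]
    push_cast
    exact Finset.sum_congr rfl fun j _ => by ring
  have hsum := trigPoly_smul_eq_linearCombination 1 (humpCoeff L K) 0
  rw [one_smul, linearCombination_humpCoeff] at hsum
  simp only [Pi.one_apply, fourier_eval_zero, mul_one, smul_eq_mul, ← hmass, Finset.sum_const,
    Finset.card_range, nsmul_eq_mul, div_mul_cancel₀ _ hL0, sub_self] at hsum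
  exact hsum

theorem exists_abs_le_pi_coe_eq (x : AddCircle (2 * π)) :
    ∃ t : ℝ, |t| ≤ π ∧ (t : AddCircle (2 * π)) = x := by
  have hx : x ∈ ((↑) : ℝ → AddCircle (2 * π)) '' Set.Icc (-π) (-π + 2 * π) := by
    rw [AddCircle.coe_image_Icc_eq]
    trivial
  obtain ⟨t, ht, rfl⟩ := hx
  exact ⟨t, abs_le.2 ⟨ht.1, by linarith [ht.2]⟩, rfl⟩

theorem norm_deriv_trigPoly_humpCoeff_le {L : ℕ} (hL : 1 ≤ L) (K : ℕ) (x : AddCircle (2 * π)) :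
    ‖trigPoly ((fun k : ℤ => Complex.I * k) • humpCoeff L K) x‖ ≤ 2 * (1 + π) + 4 := by
  obtain ⟨t, ht, rfl⟩ := exists_abs_le_pi_coe_eq x
  rw [trigPoly_smul_eq_linearCombination, linearCombination_humpCoeff]
  refine norm_sub_le_of_le ?_ ?_
  · have hsin : ∑ j ∈ Finset.Ico L K, ((j : ℂ) ^ 2)⁻¹ •
        (Complex.I * ((j : ℤ) : ℂ) * fourier (j : ℤ) (t : AddCircle (2 * π)) +
          Complex.I * ((-(j : ℤ) : ℤ) : ℂ) * fourier (-(j : ℤ)) (t : AddCircle (2 * π))) =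
        ((-2 * ∑ j ∈ Finset.Ico L K, sin (j * t) / j : ℝ) : ℂ) := by
      rw [Finset.mul_sum, Complex.ofReal_sum]
      refine Finset.sum_congr rfl fun j hj => ?_
      have hj0 : (j : ℂ) ≠ 0 := by
        exact_mod_cast (by linarith [(Finset.mem_Ico.1 hj).1] : 0 < j).ne'
      simp only [fourier_coe_two_pi, smul_eq_mul]
      push_cast
      rw [show Complex.I * (j : ℂ) * t = (j * t) * Complex.I by ring,
        show Complex.I * (-(j : ℂ)) * t = -(j * t) * Complex.I by ring, Complex.sin]
      field_simp
      ring_nf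
    rw [hsin, Complex.norm_real, norm_mul, norm_neg, Real.norm_two]
    exact mul_le_mul_of_nonneg_left (abs_sum_Ico_sin_div_le ht hL K) two_pos.le
  · have hterm : ∀ j ∈ Finset.range L,
        ‖Complex.I * ((j : ℤ) : ℂ) * fourier (j : ℤ) (t : AddCircle (2 * π))‖ ≤ L := fun j hj => by
      rw [norm_mul, norm_mul, Complex.norm_I, one_mul, norm_fourier_apply, mul_one,
        Int.cast_natCast, Complex.norm_natCast]
      exact_mod_cast (Finset.mem_range.1 hj).le
    calc _ ≤ 4 / (L : ℝ) ^ 2 * (L * L) := by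
          rw [norm_smul]
          refine mul_le_mul (norm_humpMass_div_le hL K) ?_ (norm_nonneg _) (by positivity)
          simpa using norm_sum_le_of_le _ hterm
      _ = 4 := by field_simp

theorem sum_Ico_norm_inv_sq_sq_le {L : ℕ} (hL : 1 ≤ L) (K : ℕ) :
    ∑ j ∈ Finset.Ico L K, ‖((j : ℂ) ^ 2)⁻¹‖ ^ 2 ≤ 2 / (L : ℝ) ^ 3 := by
  calc _ ≤ ∑ j ∈ Finset.Ico L K, ((L : ℝ) ^ 2)⁻¹ * ((j : ℝ) ^ 2)⁻¹ := by
        refine Finset.sum_le_sum fun j hj => ?_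
        have hLj : (L : ℝ) ≤ j := by exact_mod_cast (Finset.mem_Ico.1 hj).1
        rw [norm_inv, norm_pow, Complex.norm_natCast, sq (_⁻¹)]
        gcongr
    _ ≤ ((L : ℝ) ^ 2)⁻¹ * (2 / L) := by
        rw [← Finset.mul_sum]
        gcongr
        exact sum_Ico_inv_sq_le hL K
    _ = 2 / (L : ℝ) ^ 3 := by field_simp

theorem sum_range_norm_humpMass_div_sq_le {L : ℕ} (hL : 1 ≤ L) (K : ℕ) :
    ∑ _j ∈ Finset.range L, ‖(humpMass L K / L : ℂ)‖ ^ 2 ≤ 16 / (L : ℝ) ^ 3 := by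
  calc _ ≤ ∑ _j ∈ Finset.range L, (4 / (L : ℝ) ^ 2) ^ 2 := by
        gcongr
        exact norm_humpMass_div_le hL K
    _ = 16 / (L : ℝ) ^ 3 := by
        rw [Finset.sum_const, Finset.card_range, nsmul_eq_mul]
        field_simp
        norm_num

theorem integral_norm_trigPoly_humpCoeff_le {L : ℕ} (hL : 1 ≤ L) (K : ℕ) :
    ∫ x, ‖trigPoly (humpCoeff L K) x‖ ∂AddCircle.haarAddCircle ≤
      2 * √(2 / (L : ℝ) ^ 3) + √(16 / (L : ℝ) ^ 3) := by
  have hhigh := sqrt_le_sqrt (sum_Ico_norm_inv_sq_sq_le hL K)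
  have hlow := sqrt_le_sqrt (sum_range_norm_humpMass_div_sq_le hL K)
  refine (integral_norm_trigPoly_sub_le _ _).trans (add_le_add ?_
    ((integral_norm_trigPoly_sum_single_le _ Nat.cast_injective.injOn _).trans hlow))
  rw [two_mul (√_)]
  exact (integral_norm_trigPoly_add_le _ _).trans (add_le_add
    ((integral_norm_trigPoly_sum_single_le _ Nat.cast_injective.injOn _).trans hhigh)
    ((integral_norm_trigPoly_sum_single_le _
      (neg_injective.comp Nat.cast_injective).injOn _).trans hhigh))

theorem integral_norm_trigPoly_humpCoeff_sq_le {M : ℕ} (hM : 1 ≤ M) (K : ℕ) :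
    ∫ x, ‖trigPoly (humpCoeff (M ^ 2) K) x‖ ∂AddCircle.haarAddCircle ≤ 8 / (M : ℝ) ^ 3 := by
  have hpow : (((M ^ 2 : ℕ) : ℝ)) ^ 3 = ((M : ℝ) ^ 3) ^ 2 := by push_cast; ring
  have hdiv : ∀ a : ℝ, √(a ^ 2 / ((M : ℝ) ^ 3) ^ 2) = |a| / (M : ℝ) ^ 3 := fun a => by
    rw [← div_pow, sqrt_sq_eq_abs, abs_div, abs_of_nonneg (a := (M : ℝ) ^ 3) (by positivity)]
  have hbound := integral_norm_trigPoly_humpCoeff_le (Nat.one_le_pow 2 M hM) K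
  rw [hpow] at hbound
  calc _ ≤ _ := hbound
    _ ≤ 2 * √(2 ^ 2 / ((M : ℝ) ^ 3) ^ 2) + √(4 ^ 2 / ((M : ℝ) ^ 3) ^ 2) := by
        gcongr <;> norm_num
    _ = 8 / (M : ℝ) ^ 3 := by
        rw [hdiv, hdiv, Nat.abs_ofNat, Nat.abs_ofNat]
        ring

/-- The coefficients of the derivative of `e^{iNt} ∑ₖ bₖ e^{ikt}`. -/
def modulatedDeriv (N : ℤ) (b : ℤ →₀ ℂ) : ℤ →₀ ℂ :=
  (fun k : ℤ => Complex.I * k) • b.equivMapDomain (Equiv.addRight N)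

theorem trigPoly_smul_modulatedDeriv (m : ℤ → ℂ) (N : ℤ) (b : ℤ →₀ ℂ) (x : AddCircle (2 * π)) :
    trigPoly (m • modulatedDeriv N b) x = Finsupp.linearCombination ℂ
      (fun k : ℤ => m (k + N) * (Complex.I * (k + N)) * fourier (k + N) x) b := by
  rw [modulatedDeriv, smul_smul, trigPoly_smul_eq_linearCombination,
    Finsupp.linearCombination_equivMapDomain]
  congr 1
  ext k
  simp

theorem trigPoly_modulatedDeriv (N : ℤ) (b : ℤ →₀ ℂ) (x : AddCircle (2 * π)) :
    trigPoly (modulatedDeriv N b) x = fourier N x *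
      (Complex.I * N * trigPoly b x + trigPoly ((fun k : ℤ => Complex.I * k) • b) x) := by
  have hexpand := trigPoly_smul_modulatedDeriv 1 N b x
  rw [one_smul, Finsupp.linearCombination_apply, Finsupp.sum] at hexpand
  rw [hexpand, trigPoly_apply, trigPoly_smul_apply, Finset.mul_sum, ← Finset.sum_add_distrib,
    Finset.mul_sum]
  refine Finset.sum_congr rfl fun k _ => ?_
  rw [fourier_add, smul_eq_mul, Pi.one_apply]
  ring

theorem integral_norm_trigPoly_modulatedDeriv_le (N : ℕ) {b : ℤ →₀ ℂ} {B : ℝ}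
    (hB : ∀ x, ‖trigPoly ((fun k : ℤ => Complex.I * k) • b) x‖ ≤ B) :
    ∫ x, ‖trigPoly (modulatedDeriv N b) x‖ ∂AddCircle.haarAddCircle ≤
      N * ∫ x, ‖trigPoly b x‖ ∂AddCircle.haarAddCircle + B := by
  have hbound : ∀ x, ‖trigPoly (modulatedDeriv N b) x‖ ≤ N * ‖trigPoly b x‖ + B := fun x => by
    rw [trigPoly_modulatedDeriv, norm_mul, norm_fourier_apply, one_mul]
    refine norm_add_le_of_le ?_ (hB x)
    rw [norm_mul, norm_mul, Complex.norm_I, one_mul, Int.cast_natCast, Complex.norm_natCast]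
  have hint := (integrable_norm_trigPoly b).const_mul (N : ℝ)
  calc _ ≤ ∫ x, (N * ‖trigPoly b x‖ + B) ∂AddCircle.haarAddCircle :=
        integral_mono (integrable_norm_trigPoly _) (hint.add (integrable_const B)) hbound
    _ = _ := by
        rw [integral_add hint (integrable_const B), integral_const_mul, integral_const,
          probReal_univ, one_smul]

theorem norm_intervalIntegral_trigPoly_modulatedDeriv_le (N : ℤ) {b : ℤ →₀ ℂ} {B : ℝ}
    (h0 : trigPoly b 0 = 0) (hB : ∀ x, ‖trigPoly ((fun k : ℤ => Complex.I * k) • b) x‖ ≤ B)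
    (y : ℝ) : ‖∫ t in (0 : ℝ)..y, trigPoly (modulatedDeriv N b) t‖ ≤ B * |y| := by
  have hprimitive : ∫ t in (0 : ℝ)..y, trigPoly (modulatedDeriv N b) t =
      fourier N (y : AddCircle (2 * π)) * trigPoly b y := by
    rw [modulatedDeriv, intervalIntegral.integral_eq_sub_of_hasDerivAt
      (fun t _ => hasDerivAt_trigPoly _ t) (Continuous.intervalIntegrable (by fun_prop) _ _),
      trigPoly_equivMapDomain_addRight]
    simp [h0]
  have hlip := convex_univ.norm_image_sub_le_of_norm_hasDerivWithin_le
    (fun t _ => (hasDerivAt_trigPoly b t).hasDerivWithinAt) (fun t _ => hB t)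
    (Set.mem_univ 0) (Set.mem_univ y)
  rwa [QuotientAddGroup.mk_zero, h0, sub_zero, sub_zero, norm_eq_abs, ← one_mul ‖_‖,
    ← norm_fourier_apply N y, ← norm_mul, ← hprimitive] at hlip

theorem multiplierMean_modulatedDeriv_humpCoeff {φ : ℝ → ℝ} (hφ : ∀ x, 1 ≤ |x| → φ x = 0)
    (L K n : ℕ) :
    multiplierMean φ (trigPoly (modulatedDeriv (n + 1) (humpCoeff L K))) n 0 =
      Complex.I * (∑ j ∈ Finset.Ico L K,
        ((j : ℝ) ^ 2)⁻¹ * ((n + 1 - j) * φ (1 - j / (n + 1))) : ℝ) := by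
  have hn : (n : ℝ) + 1 ≠ 0 := by positivity
  have hvanish : ∀ j : ℕ, φ (((j : ℝ) + (n + 1)) / (n + 1)) = 0 := fun j => hφ _ <| by
    rw [abs_of_nonneg (by positivity), one_le_div (by positivity)]
    exact le_add_of_nonneg_left j.cast_nonneg
  have hreflect : ∀ j : ℕ, (-(j : ℝ) + (n + 1)) / (n + 1) = 1 - j / (n + 1) := fun j => by
    field_simp
    ring
  rw [multiplierMean_trigPoly, trigPoly_smul_modulatedDeriv, linearCombination_humpCoeff]
  simp only [QuotientAddGroup.mk_zero, fourier_eval_zero, mul_one]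
  push_cast
  simp only [hvanish, hreflect, Complex.ofReal_zero, zero_mul, Finset.sum_const_zero, mul_zero,
    sub_zero, zero_add, smul_eq_mul]
  rw [Finset.mul_sum]
  refine Finset.sum_congr rfl fun j _ => ?_
  ring

theorem mul_log_div_le_norm_multiplierMean {φ : ℝ → ℝ} (hφ : ∀ x, 1 ≤ |x| → φ x = 0) {c : ℝ}
    (hc : 0 ≤ c) (hφ1 : ∀ u, 0 ≤ u → u ≤ 1 / 2 → c * u ≤ φ (1 - u)) {L K n : ℕ} (hL : 1 ≤ L)
    (hLK : L ≤ K) (hK : 2 * K ≤ n + 1) :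
    c / 2 * log (K / L) ≤
      ‖multiplierMean φ (trigPoly (modulatedDeriv (n + 1) (humpCoeff L K))) n 0‖ := by
  have hterm : ∀ j ∈ Finset.Ico L K, c / 2 * (j : ℝ)⁻¹ ≤
      ((j : ℝ) ^ 2)⁻¹ * ((n + 1 - j) * φ (1 - j / (n + 1))) := fun j hj => by
    rw [Finset.mem_Ico] at hj
    have hj0 : (0 : ℝ) < j := by exact_mod_cast hL.trans hj.1
    have hjn : 2 * (j : ℝ) ≤ n + 1 := by exact_mod_cast (by omega : 2 * j ≤ n + 1)
    calc c / 2 * (j : ℝ)⁻¹ = ((j : ℝ) ^ 2)⁻¹ * ((n + 1) / 2 * (c * (j / (n + 1)))) := by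
          field_simp
      _ ≤ _ := by
          refine mul_le_mul_of_nonneg_left (mul_le_mul (by linarith) (hφ1 _ (by positivity) ?_)
            (by positivity) (by linarith)) (by positivity)
          rw [div_le_iff₀ (by positivity)]
          linarith
  rw [multiplierMean_modulatedDeriv_humpCoeff hφ, norm_mul, Complex.norm_I, one_mul,
    Complex.norm_real]
  calc c / 2 * log (K / L) ≤ c / 2 * ∑ j ∈ Finset.Ico L K, (j : ℝ)⁻¹ := by
        gcongr
        exact log_div_le_sum_Ico_inv hL hLK
    _ ≤ ∑ j ∈ Finset.Ico L K, ((j : ℝ) ^ 2)⁻¹ * ((n + 1 - j) * φ (1 - j / (n + 1))) := by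
        rw [Finset.mul_sum]
        exact Finset.sum_le_sum hterm
    _ ≤ _ := le_norm_self _

/-! ### Superpositions of integrable functions -/

theorem integrable_tsum_of_summable_integral_norm {ι X E : Type*} [Countable ι]
    [MeasurableSpace X] [NormedAddCommGroup E] [CompleteSpace E] {μ : Measure X} {F : ι → X → E}
    (hF : ∀ i, Integrable (F i) μ) (hsum : Summable fun i => ∫ x, ‖F i x‖ ∂μ) :
    Integrable (fun x => ∑' i, F i x) μ := by
  have hfin : ∫⁻ x, ∑' i, ‖F i x‖ₑ ∂μ < ⊤ := by
    rw [lintegral_tsum fun i => (hF i).1.enorm]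
    simp only [← ofReal_integral_norm_eq_lintegral_enorm (hF _)]
    exact hsum.tsum_ofReal_lt_top
  have hsummable : ∀ᵐ x ∂μ, Summable fun i => F i x := by
    filter_upwards [ae_lt_top' (AEMeasurable.tsum fun i => (hF i).1.enorm) hfin.ne] with x hx
    exact (ENNReal.tsum_coe_ne_top_iff_summable.1 hx.ne).of_nnnorm
  have hmeas : AEStronglyMeasurable (fun x => ∑' i, F i x) μ := by
    refine aestronglyMeasurable_of_tendsto_ae (atTop : Filter (Finset ι))
      (f := fun s x => ∑ i ∈ s, F i x)
      (fun s => Finset.aestronglyMeasurable_fun_sum _ fun i _ => (hF i).1) ?_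
    filter_upwards [hsummable] with x hx
    exact hx.hasSum
  exact ⟨hmeas, (lintegral_mono fun x => enorm_tsum_le_tsum_enorm).trans_lt hfin⟩

section Superposition

variable {a : ℕ → ℂ} {F : ℕ → AddCircle (2 * π) → ℂ} {C : ℝ}

theorem summable_integral_norm_const_mul (ha : Summable fun i => ‖a i‖)
    (hC : ∀ i, ∫ x, ‖F i x‖ ∂AddCircle.haarAddCircle ≤ C) :
    Summable fun i => ∫ x, ‖a i * F i x‖ ∂AddCircle.haarAddCircle := by
  refine .of_nonneg_of_le (fun _ => integral_nonneg fun _ => norm_nonneg _) (fun i => ?_)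
    (ha.mul_right C)
  simp only [norm_mul, integral_const_mul]
  exact mul_le_mul_of_nonneg_left (hC i) (norm_nonneg _)

theorem integrable_tsum_mul (ha : Summable fun i => ‖a i‖)
    (hF : ∀ i, Integrable (F i) AddCircle.haarAddCircle)
    (hC : ∀ i, ∫ x, ‖F i x‖ ∂AddCircle.haarAddCircle ≤ C) :
    Integrable (fun x => ∑' i, a i * F i x) AddCircle.haarAddCircle :=
  integrable_tsum_of_summable_integral_norm (fun i => (hF i).const_mul _)
    (summable_integral_norm_const_mul ha hC)

theorem hasSum_fourierCoeff_tsum_mul (ha : Summable fun i => ‖a i‖)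
    (hF : ∀ i, Integrable (F i) AddCircle.haarAddCircle)
    (hC : ∀ i, ∫ x, ‖F i x‖ ∂AddCircle.haarAddCircle ≤ C) (k : ℤ) :
    HasSum (fun i => a i * fourierCoeff (F i) k)
      (fourierCoeff (fun x => ∑' i, a i * F i x) k) := by
  have h := hasSum_integral_of_summable_integral_norm
    (fun i => ((hF i).const_mul (a i)).fourier_smul (-k)) (by
      simpa only [norm_smul, norm_fourier_apply, one_mul] using
        summable_integral_norm_const_mul ha hC)
  simpa only [fourierCoeff, smul_eq_mul, ← tsum_mul_left, mul_left_comm _ (a _),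
    integral_const_mul] using h

theorem multiplierMean_eq_sum {φ : ℝ → ℝ} (hφ : ∀ x, 1 ≤ |x| → φ x = 0)
    (f : AddCircle (2 * π) → ℂ) (n : ℕ) (x : ℝ) :
    multiplierMean φ f n x = ∑ k ∈ Finset.Icc (-(n : ℤ)) n,
      (φ ((k : ℝ) / ((n : ℝ) + 1)) : ℂ) * fourierCoeff f k * Complex.exp (Complex.I * k * x) := by
  refine tsum_eq_sum fun k hk => ?_
  rw [hφ _ (one_le_abs_div_of_notMem_Icc hk), Complex.ofReal_zero, zero_mul, zero_mul]

theorem hasSum_multiplierMean_tsum_mul {φ : ℝ → ℝ} (hφ : ∀ x, 1 ≤ |x| → φ x = 0)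
    (ha : Summable fun i => ‖a i‖) (hF : ∀ i, Integrable (F i) AddCircle.haarAddCircle)
    (hC : ∀ i, ∫ x, ‖F i x‖ ∂AddCircle.haarAddCircle ≤ C) (n : ℕ) (x : ℝ) :
    HasSum (fun i => a i * multiplierMean φ (F i) n x)
      (multiplierMean φ (fun y => ∑' i, a i * F i y) n x) := by
  simp only [multiplierMean_eq_sum hφ]
  refine (hasSum_sum fun k _ => ((hasSum_fourierCoeff_tsum_mul ha hF hC k).mul_left
    (φ ((k : ℝ) / ((n : ℝ) + 1)) : ℂ)).mul_right (Complex.exp (Complex.I * k * x))).congr_fun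
      fun i => ?_
  rw [Finset.mul_sum]
  exact Finset.sum_congr rfl fun k _ => by ring

theorem exists_norm_multiplierMean_le {φ : ℝ → ℝ} (hφ : ∀ x, 1 ≤ |x| → φ x = 0)
    (hC : ∀ i, ∫ x, ‖F i x‖ ∂AddCircle.haarAddCircle ≤ C) (n : ℕ) (x : ℝ) :
    ∃ R, ∀ i, ‖multiplierMean φ (F i) n x‖ ≤ R := by
  refine ⟨∑ k ∈ Finset.Icc (-(n : ℤ)) n, ‖φ ((k : ℝ) / ((n : ℝ) + 1))‖ * C *
    ‖Complex.exp (Complex.I * k * x)‖, fun i => ?_⟩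
  rw [multiplierMean_eq_sum hφ]
  refine norm_sum_le_of_le _ fun k _ => ?_
  have hcoeff : ‖fourierCoeff (F i) k‖ ≤ C := by
    refine (norm_integral_le_integral_norm _).trans ?_
    simpa only [norm_smul, norm_fourier_apply, one_mul] using hC i
  rw [norm_mul, norm_mul, Complex.norm_real]
  gcongr

theorem hasSum_intervalIntegral_tsum_mul (ha : Summable fun i => ‖a i‖)
    (hF : ∀ i, Integrable (F i) AddCircle.haarAddCircle)
    (hC : ∀ i, ∫ x, ‖F i x‖ ∂AddCircle.haarAddCircle ≤ C) {y : ℝ} (hy : |y| ≤ π) :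
    HasSum (fun i => a i * ∫ t in (0 : ℝ)..y, F i t)
      (∫ t in (0 : ℝ)..y, ∑' i, a i * F i t) := by
  have hsub : Set.uIoc 0 y ⊆ Set.Ioc (-π) π := by
    obtain ⟨hy1, hy2⟩ := abs_le.1 hy
    exact Set.Ioc_subset_Ioc (le_min (neg_nonpos.2 pi_pos.le) hy1) (max_le pi_pos.le hy2)
  have hint : ∀ i, IntegrableOn (fun t : ℝ => a i * F i t) (Set.Ioc (-π) π) := fun i =>
    (intervalIntegrable_iff_integrableOn_Ioc_of_le (by linarith [pi_pos])).1
      (intervalIntegrable_of_integrable_haarAddCircle ((hF i).const_mul _) _ _)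
  have hle : ∀ i, ∫ t in Set.uIoc 0 y, ‖a i * F i t‖ ≤
      2 * π * ∫ x, ‖a i * F i x‖ ∂AddCircle.haarAddCircle := fun i => by
    rw [integral_haarAddCircle_eq_intervalIntegral _ (-π), show -π + 2 * π = π by ring,
      smul_eq_mul, mul_inv_cancel_left₀ two_pi_pos.ne',
      intervalIntegral.integral_of_le (by linarith [pi_pos])]
    exact setIntegral_mono_set (hint i).norm (.of_forall fun _ => norm_nonneg _)
      hsub.eventuallyLE
  have hsum := (hasSum_integral_of_summable_integral_norm (fun i => (hint i).mono_set hsub)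
    (.of_nonneg_of_le (fun _ => integral_nonneg fun _ => norm_nonneg _) hle
      ((summable_integral_norm_const_mul ha hC).mul_left _))).const_smul
        (if (0 : ℝ) ≤ y then (1 : ℝ) else -1)
  simpa only [← intervalIntegral.intervalIntegral_eq_integral_uIoc,
    intervalIntegral.integral_const_mul] using hsum

theorem isDPointWith_tsum_mul {d : ℕ → ℂ} {B : ℝ} (ha : Summable fun i => ‖a i‖)
    (hF : ∀ i, Integrable (F i) AddCircle.haarAddCircle)
    (hC : ∀ i, ∫ x, ‖F i x‖ ∂AddCircle.haarAddCircle ≤ C)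
    (hB : ∀ i (y : ℝ), |y| ≤ π → ‖∫ t in (0 : ℝ)..y, F i t‖ ≤ B * |y|)
    (hd : ∀ i, IsDPointWith (F i) 0 (d i)) :
    IsDPointWith (fun x => ∑' i, a i * F i x) 0 (∑' i, a i * d i) := by
  have hsmall : ∀ᶠ y : ℝ in 𝓝[≠] 0, |y| ≤ π := nhdsWithin_le_nhds <|
    (continuous_abs.tendsto' 0 0 abs_zero).eventually_le_const pi_pos
  have hlim : Tendsto (fun y : ℝ => ∑' i, y⁻¹ • (a i * ∫ t in (0 : ℝ)..y, F i t)) (𝓝[≠] 0)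
      (𝓝 (∑' i, a i * d i)) := by
    refine tendsto_tsum_of_dominated_convergence (ha.mul_right B) (fun i => ?_) ?_
    · have hslope := hasDerivAt_iff_tendsto_slope_zero.1 (hd i)
      simp only [zero_add, intervalIntegral.integral_same, sub_zero] at hslope
      simpa only [mul_smul_comm] using hslope.const_mul (a i)
    · filter_upwards [hsmall, self_mem_nhdsWithin] with y hy hy0 i
      rw [norm_smul, norm_mul, norm_inv, norm_eq_abs, mul_left_comm]
      refine mul_le_mul_of_nonneg_left ?_ (norm_nonneg _)
      rw [inv_mul_le_iff₀ (abs_pos.2 hy0), mul_comm |y|]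
      exact hB i y hy
  refine hasDerivAt_iff_tendsto_slope_zero.2 (hlim.congr' ?_)
  filter_upwards [hsmall] with y hy
  simp only [zero_add, intervalIntegral.integral_same, sub_zero]
  exact ((hasSum_intervalIntegral_tsum_mul ha hF hC hy).const_smul y⁻¹).tsum_eq

end Superposition

/-! ### Divergence -/

open scoped lp in
theorem exists_summable_norm_unbounded_tsum_smul {ι κ 𝕜 E : Type*} [NontriviallyNormedField 𝕜]
    [CompleteSpace 𝕜] [NormedAddCommGroup E] [NormedSpace 𝕜 E] [CompleteSpace E] {u : ι → κ → E}
    (hrow : ∀ n, ∃ R, ∀ i, ‖u n i‖ ≤ R) (hu : ∀ R, ∃ n i, R < ‖u n i‖) :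
    ∃ a : κ → 𝕜, (Summable fun i => ‖a i‖) ∧ ∀ R, ∃ n, R < ‖∑' i, a i • u n i‖ := by
  classical
  by_contra! hbdd
  choose R hR using hrow
  let g : ι → ℓ¹(κ, 𝕜) →L[𝕜] E := fun n => (lp.tsumCLM 𝕜 κ E).comp <|
    lp.mapCLM 1 (fun i => ContinuousLinearMap.toSpanSingleton 𝕜 (u n i)) (abs_nonneg (R n))
      fun i => by
        rw [ContinuousLinearMap.norm_toSpanSingleton]
        exact (hR n i).trans (le_abs_self _)
  have hg : ∀ n x, g n x = ∑' i, x i • u n i := fun n x => rfl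
  obtain ⟨C, hC⟩ := banach_steinhaus (g := g) fun x =>
    hbdd x (by simpa using (lp.memℓp x).summable (by simp))
  obtain ⟨n, i, hlt⟩ := hu C
  refine hlt.not_ge ?_
  have hsingle : g n (lp.single 1 i 1) = u n i := by
    rw [hg, tsum_eq_single i fun j hj => by rw [lp.single_apply_ne _ _ _ hj, zero_smul],
      lp.single_apply_self, one_smul]
  calc ‖u n i‖ ≤ ‖g n‖ * ‖lp.single (E := fun _ : κ => 𝕜) 1 i 1‖ :=
        hsingle ▸ (g n).le_opNorm _
    _ ≤ C := by
        rw [lp.norm_single one_pos, norm_one, mul_one]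
        exact hC n

theorem exists_isDPointWith_not_tendsto_of_unbounded {φ : ℝ → ℝ} (hφ : ∀ x, 1 ≤ |x| → φ x = 0)
    {F : ℕ → AddCircle (2 * π) → ℂ} {d : ℕ → ℂ} {B C : ℝ}
    (hF : ∀ i, Integrable (F i) AddCircle.haarAddCircle)
    (hC : ∀ i, ∫ x, ‖F i x‖ ∂AddCircle.haarAddCircle ≤ C)
    (hB : ∀ i (y : ℝ), |y| ≤ π → ‖∫ t in (0 : ℝ)..y, F i t‖ ≤ B * |y|)
    (hd : ∀ i, IsDPointWith (F i) 0 (d i))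
    (hunbdd : ∀ R, ∃ n i, R < ‖multiplierMean φ (F i) n 0‖) :
    ∃ f : AddCircle (2 * π) → ℂ, Integrable f AddCircle.haarAddCircle ∧
      (∃ d, IsDPointWith f 0 d) ∧
      ¬∃ L : ℂ, Tendsto (fun n : ℕ => multiplierMean φ f n 0) atTop (𝓝 L) := by
  obtain ⟨a, ha, hdiv⟩ := exists_summable_norm_unbounded_tsum_smul (𝕜 := ℂ)
    (fun n => exists_norm_multiplierMean_le hφ hC n 0) hunbdd
  refine ⟨fun x => ∑' i, a i * F i x, integrable_tsum_mul ha hF hC,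
    ⟨_, isDPointWith_tsum_mul ha hF hC hB hd⟩, ?_⟩
  rintro ⟨L, hL⟩
  obtain ⟨R, hR⟩ := hL.norm.bddAbove_range
  obtain ⟨n, hn⟩ := hdiv R
  refine hn.not_ge ?_
  simp only [smul_eq_mul, (hasSum_multiplierMean_tsum_mul hφ ha hF hC n 0).tsum_eq]
  exact hR ⟨n, rfl⟩

theorem isDPointWith_of_continuous {f : AddCircle (2 * π) → ℂ} (hf : Continuous f) (x : ℝ) :
    IsDPointWith f x (f x) := by
  have hcont : Continuous fun t : ℝ => f t := hf.comp (AddCircle.continuous_mk' _)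
  exact (hcont.integral_hasStrictDerivAt 0 x).hasDerivAt

theorem integral_norm_trigPoly_modulatedDeriv_humpCoeff_le {M N : ℕ} (hM : 1 ≤ M)
    (hN : N ≤ 2 * M ^ 3) :
    ∫ x, ‖trigPoly (modulatedDeriv N (humpCoeff (M ^ 2) (M ^ 3))) x‖ ∂AddCircle.haarAddCircle ≤
      16 + (2 * (1 + π) + 4) := by
  have hM0 : (M : ℝ) ≠ 0 := by positivity
  refine (integral_norm_trigPoly_modulatedDeriv_le N
    (norm_deriv_trigPoly_humpCoeff_le (Nat.one_le_pow _ _ hM) _)).trans ?_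
  gcongr
  calc _ ≤ (2 * (M : ℝ) ^ 3) * (8 / (M : ℝ) ^ 3) := by
        gcongr
        · exact_mod_cast hN
        · exact integral_norm_trigPoly_humpCoeff_sq_le hM _
    _ = 16 := by
        field_simp
        norm_num

theorem exists_isDPointWith_not_tendsto_multiplierMean {φ : ℝ → ℝ}
    (hφ : ∀ x, 1 ≤ |x| → φ x = 0) {c : ℝ} (hc : 0 < c)
    (hφ1 : ∀ u, 0 ≤ u → u ≤ 1 / 2 → c * u ≤ φ (1 - u)) :
    ∃ f : AddCircle (2 * π) → ℂ, Integrable f AddCircle.haarAddCircle ∧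
      (∃ d, IsDPointWith f 0 d) ∧
      ¬∃ L : ℂ, Tendsto (fun n : ℕ => multiplierMean φ f n 0) atTop (𝓝 L) := by
  let n : ℕ → ℕ := fun i => 2 * (i + 1) ^ 3 - 1
  have hn : ∀ i, n i + 1 = 2 * (i + 1) ^ 3 := fun i =>
    Nat.sub_add_cancel (Nat.mul_pos two_pos (by positivity))
  let F : ℕ → C(AddCircle (2 * π), ℂ) := fun i =>
    trigPoly (modulatedDeriv (n i + 1) (humpCoeff ((i + 1) ^ 2) ((i + 1) ^ 3)))
  have hL : ∀ i : ℕ, 1 ≤ (i + 1) ^ 2 := fun i => Nat.one_le_pow _ _ i.succ_pos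
  have hmean : ∀ i : ℕ, c / 2 * log (i + 1) ≤ ‖multiplierMean φ (F i) (n i) 0‖ := fun i => by
    have h := mul_log_div_le_norm_multiplierMean hφ hc.le hφ1 (hL i)
      (Nat.pow_le_pow_right i.succ_pos (by norm_num : 2 ≤ 3)) (hn i).ge
    have hquot : (((i + 1) ^ 3 : ℕ) : ℝ) / ((i + 1) ^ 2 : ℕ) = i + 1 := by
      push_cast
      field_simp
    rwa [hquot] at h
  refine exists_isDPointWith_not_tendsto_of_unbounded hφ (F := fun i => F i)
    (fun i => (map_continuous (F i)).integrable_of_hasCompactSupport (.of_compactSpace _))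
    (fun i => integral_norm_trigPoly_modulatedDeriv_humpCoeff_le i.succ_pos (hn i).le)
    (fun i y _ => norm_intervalIntegral_trigPoly_modulatedDeriv_le _
      (trigPoly_humpCoeff_zero (hL i) _) (norm_deriv_trigPoly_humpCoeff_le (hL i) _) y)
    (fun i => isDPointWith_of_continuous (map_continuous (F i)) 0) fun R => ?_
  have hlog : Tendsto (fun i : ℕ => c / 2 * log ((i : ℝ) + 1)) atTop atTop :=
    (tendsto_log_atTop.comp (tendsto_atTop_add_const_right _ _
      tendsto_natCast_atTop_atTop)).const_mul_atTop (half_pos hc)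
  obtain ⟨i, hi⟩ := (hlog.eventually_gt_atTop R).exists
  exact ⟨n i, i, hi.trans_le (hmean i)⟩

theorem mul_le_one_sub_rpow {α : ℝ} (hα : 0 < α) {u : ℝ} (hu0 : 0 ≤ u) (hu1 : u ≤ 1) :
    min α 1 * u ≤ 1 - (1 - u) ^ α := by
  have h0 : 0 ≤ 1 - u := sub_nonneg.2 hu1
  rcases le_total α 1 with h | h
  · rw [min_eq_left h]
    have hbernoulli := rpow_one_add_le_one_add_mul_self (s := -u) (by linarith) hα.le h
    rw [← sub_eq_add_neg] at hbernoulli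
    linarith
  · rw [min_eq_right h]
    have hpow := rpow_le_rpow_of_exponent_ge' h0 (by linarith) zero_le_one h
    rw [rpow_one] at hpow
    linarith

theorem mul_le_rieszFun_one_sub {α β : ℝ} (hα : 0 < α) (hβ : 0 ≤ β) (hβ1 : β ≤ 1) {u : ℝ}
    (hu0 : 0 ≤ u) (hu1 : u ≤ 1) : min α 1 * u ≤ rieszFun α β (1 - u) := by
  have h0 : 0 ≤ 1 - u := sub_nonneg.2 hu1
  have hle := mul_le_one_sub_rpow hα hu0 hu1
  have hnonneg : 0 ≤ 1 - (1 - u) ^ α := le_trans (by positivity) hle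
  rw [rieszFun, abs_of_nonneg h0, max_eq_left hnonneg]
  have hpow := rpow_le_rpow_of_exponent_ge' hnonneg (by linarith [rpow_nonneg h0 α]) hβ hβ1
  rw [rpow_one] at hpow
  exact hle.trans hpow

end

theorem mainTheorem8 (α β : ℝ) (hα : 0 < α) (hβ : 0 < β) :
    (1 < β ↔ ∀ f : AddCircle (2 * π) → ℂ, Integrable f AddCircle.haarAddCircle →
      ∀ (x : ℝ) (d : ℂ), IsDPointWith f x d →
        Tendsto (fun n : ℕ => multiplierMean (rieszFun α β) f n x) atTop (𝓝 d)) ∧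
    (1 < β ↔ ∀ f : AddCircle (2 * π) → ℂ, Integrable f AddCircle.haarAddCircle →
      ∀ (x : ℝ) (d : ℂ), IsDPointWith f x d →
        ∃ L : ℂ, Tendsto (fun n : ℕ => multiplierMean (rieszFun α β) f n x) atTop (𝓝 L)) := by
  have hpos : 1 < β → ∀ f : AddCircle (2 * π) → ℂ, Integrable f AddCircle.haarAddCircle →
      ∀ (x : ℝ) (d : ℂ), IsDPointWith f x d →
        Tendsto (fun n : ℕ => multiplierMean (rieszFun α β) f n x) atTop (𝓝 d) :=
    fun h _ hf _ _ hd => (isRegularMultiplier_rieszFun hα h).tendsto_multiplierMean hf hd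
  have hneg : (∀ f : AddCircle (2 * π) → ℂ, Integrable f AddCircle.haarAddCircle →
      ∀ (x : ℝ) (d : ℂ), IsDPointWith f x d →
        ∃ L : ℂ, Tendsto (fun n : ℕ => multiplierMean (rieszFun α β) f n x) atTop (𝓝 L)) →
      1 < β := by
    intro h
    by_contra hβ1
    obtain ⟨f, hf, ⟨d, hd⟩, hdiv⟩ := exists_isDPointWith_not_tendsto_multiplierMean
      (fun _ => rieszFun_eq_zero hα hβ) (lt_min hα one_pos)
      fun u hu0 hu1 => mul_le_rieszFun_one_sub hα hβ.le (not_lt.1 hβ1) hu0 (by linarith)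
    exact hdiv (h f hf 0 d hd)
  exact ⟨⟨hpos, fun h => hneg fun f hf x d hd => ⟨d, h f hf x d hd⟩⟩,
    ⟨fun h f hf x d hd => ⟨d, hpos h f hf x d hd⟩, hneg⟩⟩
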